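/- Let $k$ be a non-zero commutative ring. For a group $G$, let $\operatorname{hd}_k(G)$ (resp. $\operatorname{cd}_k(G)$) be the least integer $n\ge 0$ such that $H_{n+1}(G,M)=0$ (resp. $H^{n+1}(G,M)=0$) for all $kG$-modules $M$, or $\infty$ if there is no such $n$. The class of elementary amenable groups is the smallest class of groups that contains all finite groups and all abelian groups and is closed under extensions and directed unions. Let $G$ be an elementary amenable group with $\operatorname{hd}_k(G)\le 1$. Then $G$ is the colimit, over a small filtered category, of a diagram of groups $H_\lambda$ such that every $H_\lambda$ satisfies $\operatorname{cd}_k(H_\lambda)\le 1$ and is either an HNN extension of a finite group $B$ along an isomorphism between two subgroups of $B$, or an amalgamated free product $B_0 *_C B_1$ of two finite groups along injective homomorphisms $C\to B_0$, $C\to B_1$ (that is, $H_\lambda$ is the fundamental group of a graph of finite groups with exactly one edge). -/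

import Mathlib

open CategoryTheory CategoryTheory.Limits

universe u

namespace GroupDim

/-- The homological dimension `hd_k(G)`: the least `n` such that `H_{n+1}(G, M) = 0` for all
`kG`-modules `M`, or `∞` if there is no such `n`. -/
noncomputable def hd (k G : Type u) [CommRing k] [Group G] : ℕ∞ :=
  ⨅ n ∈ {n : ℕ | ∀ M : Rep.{u} k G, IsZero (groupHomology M (n + 1))}, (n : ℕ∞)

/-- The cohomological dimension `cd_k(G)`: the least `n` such that `H^{n+1}(G, M) = 0` for all
`kG`-modules `M`, or `∞` if there is no such `n`. -/
noncomputable def cd (k G : Type u) [CommRing k] [Group G] : ℕ∞ :=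
  ⨅ n ∈ {n : ℕ | ∀ M : Rep.{u} k G, IsZero (groupCohomology M (n + 1))}, (n : ℕ∞)

/-- The class of elementary amenable groups: the smallest class of groups that contains all finite
groups and all abelian groups and is closed under extensions and directed unions. -/
inductive ElementaryAmenable : (G : Type u) → [Group G] → Prop
  | of_finite (G : Type u) [Group G] (h : Finite G) : ElementaryAmenable G
  | of_comm (G : Type u) [Group G] (h : ∀ a b : G, a * b = b * a) : ElementaryAmenable G
  | extension (G : Type u) [Group G] (N : Subgroup G) [N.Normal]
      (hN : ElementaryAmenable N) (hQ : ElementaryAmenable (G ⧸ N)) : ElementaryAmenable G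
  | directedUnion (G : Type u) [Group G] (S : Set (Subgroup G)) (hne : S.Nonempty)
      (hdir : DirectedOn (· ≤ ·) S) (hcover : ∀ g : G, ∃ H ∈ S, g ∈ H)
      (hS : ∀ H ∈ S, ElementaryAmenable H) : ElementaryAmenable G

/-- `H` is an HNN extension of a finite group `B`, along an isomorphism between two subgroups
of `B`. -/
def IsHNNExtensionOfFinite (H : Type u) [Group H] : Prop :=
  ∃ (B : Type u) (_ : Group B) (_ : Finite B) (A A' : Subgroup B) (φ : A ≃* A'),
    Nonempty (H ≃* HNNExtension B A A' φ)

/-- `H` is an amalgamated free product `B₀ *_C B₁` of two finite groups, formed along injective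
homomorphisms `C → B₀` and `C → B₁`. -/
def IsAmalgamOfFinite (H : Type u) [Group H] : Prop :=
  ∃ (C : Type u) (_ : Group C) (B : Fin 2 → Type u) (_ : ∀ i, Group (B i)) (_ : ∀ i, Finite (B i))
    (φ : ∀ i, C →* B i), (∀ i, Function.Injective (φ i)) ∧ Nonempty (H ≃* Monoid.PushoutI φ)

/-- `G` is the colimit, in the category of groups, of a diagram over a small filtered category all
of whose groups satisfy `P`. -/
def IsFilteredColimitOf (P : (H : Type u) → [Group H] → Prop) (G : Type u) [Group G] : Prop :=
  ∃ (J : Type u) (_ : SmallCategory J) (_ : IsFiltered J) (F : J ⥤ GrpCat.{u}) (c : Cocone F),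
    Nonempty (IsColimit c) ∧ Nonempty (c.pt ≃* G) ∧ ∀ j : J, P (F.obj j)

end GroupDim

/-! The hypothesis enters only as the vanishing of $H_1$ or of $H_2$ for all coefficients, which
passes to subgroups by Shapiro's lemma. It has two consequences.

(a) Finite subgroups have order invertible in $k$: a cyclic group of non-invertible order $n$ has
non-zero $H_1$ and $H_2$ with coefficients in $k/n$ (`SmallHomology.isUnit_orderOf`,
`SmallHomology.isUnit_natCard`).

(b) No subgroup has the form $S\rtimes\mathbb Z$ where $S$ has a non-zero homomorphism
$\ell:S\to\mathbb Q$ vanishing exactly on torsion. Up to replacing the generator of $\mathbb Z$ by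
its square, such a group acts on $\mathbb Q$ by increasing affine maps. With locally finite
functions on $\mathbb Q$ as coefficients, the translation carries an $H_1$ class that the generator
of $\mathbb Z$ fixes, and the mapping torus of this class is non-zero in $H_2$
(`not_smallHomology_of_shift`, `not_smallHomology_of_rational_hom`).

Induction over the elementary amenable class then shows that every finitely generated subgroup is
locally finite by a subgroup of $D_\infty$ (`ElementaryAmenable.isLocallyFiniteByDihedral`). The
critical step adjoins an element of infinite order modulo a subgroup $K$ that it normalizes; (b)
forces $K$ to be locally finite.

A finitely generated group $H$ of this kind is approximated by HNN extensions or amalgams of finite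
subgroups of $H$: a relation of $H$ needs only finitely many elements of its locally finite parts.
Hence every homomorphism from a finitely presented group to $G$ factors through a one-edge group
(`FactorsThroughOneEdge`). Its vertex groups have invertible order by (a), so averaging splits all
extensions with $k$-module kernel and `cd` is at most 1. One-edge groups are finitely presented, so
the factorization property makes the category of one-edge groups over $G$ filtered with colimit $G$.
-/

namespace GroupDim

open groupHomology

/-! ### Vanishing homology and its pairing with cocycles -/

section Vanishing

variable (k G : Type u) [CommRing k] [Group G]

/-- `H_n(G, M) = 0` for all `kG`-modules `M`. -/
def HomologyVanishes (n : ℕ) : Prop := ∀ M : Rep.{u} k G, IsZero (groupHomology M n)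

/-- The homology of `G` vanishes, for all coefficients, in degree one or in degree two. -/
def SmallHomology : Prop := HomologyVanishes k G 1 ∨ HomologyVanishes k G 2

variable {k G}

/-- The infimum defining `hd` is attained at 0 or 1. No dimension shifting is used, so every later
non-vanishing argument treats both degrees. -/
theorem smallHomology_of_hd_le_one (h : hd k G ≤ 1) : SmallHomology k G := by
  by_contra hne
  simp only [SmallHomology, not_or] at hne
  have : (2 : ℕ∞) ≤ hd k G := by
    refine le_iInf₂ fun n hn => ?_
    match n, hn with
    | 0, hn => exact absurd hn hne.1
    | 1, hn => exact absurd hn hne.2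
    | n + 2, _ => exact_mod_cast Nat.le_add_left 2 n
  exact absurd (this.trans h) (by decide)

/-- Shapiro's lemma. -/
theorem HomologyVanishes.subgroup {n : ℕ} (h : HomologyVanishes k G n) (S : Subgroup G) :
    HomologyVanishes k S n := fun M => by
  classical
  exact (h (Rep.ind S.subtype M)).of_iso (indIso S M n).symm

theorem SmallHomology.subgroup (h : SmallHomology k G) (S : Subgroup G) : SmallHomology k S :=
  h.imp (fun h => h.subgroup S) fun h => h.subgroup S

/-- The cocycle identity says that `F`, as a functional on one-chains, kills boundaries; the chain
`single g a` is a cycle because `g` fixes `a`. This is the test by which non-zero classes are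
detected. -/
theorem HomologyVanishes.cocycle_one_apply_eq_zero (h : HomologyVanishes k G 1) {A : Rep.{u} k G}
    {X : Type*} [AddCommGroup X] [Module k X] (F : G → A →ₗ[k] X)
    (hF : ∀ g h a, F (g * h) a = F g a + F h (A.ρ g⁻¹ a)) (g : G) (a : A) (ha : A.ρ g a = a) :
    F g a = 0 := by
  have hx : Finsupp.single g a ∈ cycles₁ A := by
    rw [single_mem_cycles₁_iff]; exact ha
  have := ModuleCat.isZero_iff_subsingleton.1 (h A)
  obtain ⟨y, hy⟩ := (H1π_eq_zero_iff (⟨_, hx⟩ : cycles₁ A)).1 (Subsingleton.elim _ _)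
  have key : Finsupp.lsum k F ∘ₗ (d₂₁ A).hom = 0 := by
    ext p a
    change Finsupp.lsum k F (d₂₁ A (Finsupp.single p a)) = 0
    rw [d₂₁_single, map_add, map_sub]
    simp [hF]
  have := LinearMap.congr_fun key y
  simpa [hy] using this

theorem HomologyVanishes.cocycle_two_apply_eq_zero (h : HomologyVanishes k G 2) {A : Rep.{u} k G}
    {X : Type*} [AddCommGroup X] [Module k X] (F : G × G → A →ₗ[k] X)
    (hF : ∀ g h j a, F (h, j) (A.ρ g⁻¹ a) - F (g * h, j) a + F (g, h * j) a - F (g, h) a = 0)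
    (x : G × G →₀ A) (hx : d₂₁ A x = 0) : Finsupp.lsum k F x = 0 := by
  have := ModuleCat.isZero_iff_subsingleton.1 (h A)
  obtain ⟨y, hy⟩ := (H2π_eq_zero_iff (⟨x, hx⟩ : cycles₂ A)).1 (Subsingleton.elim _ _)
  have key : Finsupp.lsum k F ∘ₗ (d₃₂ A).hom = 0 := by
    ext p a
    change Finsupp.lsum k F (d₃₂ A (Finsupp.single p a)) = 0
    rw [d₃₂_single, map_sub, map_add, map_sub]
    simpa using hF p.1 p.2.1 p.2.2 a
  have := LinearMap.congr_fun key y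
  simpa [hy] using this

end Vanishing

/-! ### Finite subgroups have invertible order -/

section Torsion

variable {k G : Type u} [CommRing k] [Group G]

/-- The carry of the addition of two residues. -/
def carry (n : ℕ) (a b : ZMod n) : ℤ := ((a.val : ℤ) + b.val - (a + b).val) / n

theorem mul_carry (n : ℕ) [NeZero n] (a b : ZMod n) :
    n * carry n a b = a.val + b.val - (a + b).val := by
  refine Int.mul_ediv_cancel' ?_
  rw [← ZMod.intCast_zmod_eq_zero_iff_dvd]
  simp

theorem carry_cocycle (n : ℕ) [NeZero n] (a b c : ZMod n) :
    carry n b c - carry n (a + b) c + carry n a (b + c) - carry n a b = 0 := by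
  have hn : (n : ℤ) ≠ 0 := by exact_mod_cast NeZero.ne n
  refine (mul_eq_zero.1 (?_ : (n : ℤ) * _ = 0)).resolve_left hn
  simp only [mul_sub, mul_add, mul_carry, add_assoc]
  ring

/-- Adding 1 to the residues $0,\dots,n-1$ carries exactly once. -/
theorem sum_carry (n : ℕ) [Fact (1 < n)] :
    ∑ i ∈ Finset.range n, carry n (i : ZMod n) 1 = 1 := by
  have h0 : 1 < n := Fact.out
  have : NeZero n := ⟨by omega⟩
  have hn : (n : ℤ) ≠ 0 := by exact_mod_cast NeZero.ne n
  refine mul_left_cancel₀ hn ?_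
  rw [Finset.mul_sum]
  have h1 : ∀ i : ℕ, (n : ℤ) * carry n (i : ZMod n) 1 =
      (1 : ZMod n).val - ((((i + 1 : ℕ) : ZMod n).val : ℤ) - ((i : ZMod n).val : ℤ)) := by
    intro i; rw [mul_carry]; push_cast; ring
  simp only [h1]
  rw [Finset.sum_sub_distrib, Finset.sum_range_sub (fun i => (((i : ℕ) : ZMod n).val : ℤ))]
  simp [ZMod.val_one]

/-- If $n$ is not a unit then $k/n\ne0$, and the trivial module $k/n$ has non-zero homology over
$\mathbb Z/n$: in degree one the reduction $\mathbb Z/n\to k/n$ detects a generator, in degree two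
the carry cocycle detects the standard cycle. -/
theorem SmallHomology.isUnit_orderOf (h : SmallHomology k G) {x : G} (hx : IsOfFinOrder x) :
    IsUnit ((orderOf x : ℕ) : k) := by
  by_contra hu
  set n := orderOf x with hn
  have hn1 : 1 < n := by
    have h0 : 0 < n := hx.orderOf_pos
    rcases Nat.lt_or_ge 1 n with h | h
    · exact h
    · exact absurd (by rw [le_antisymm h h0]; simp) hu
  have : Fact (1 < n) := ⟨hn1⟩
  have : NeZero n := ⟨by omega⟩
  let S := Subgroup.zpowers x
  have hcard : Nat.card S = n := Nat.card_zpowers x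
  let e : S ≃* Multiplicative (ZMod n) := hcard ▸ (zmodCyclicMulEquiv (G := S) inferInstance).symm
  let I : Ideal k := Ideal.span {(n : k)}
  have hI : Nontrivial (k ⧸ I) := Ideal.Quotient.nontrivial_iff.2 fun h => hu
    (Ideal.span_singleton_eq_top.1 h)
  have hnI : ((n : ℕ) : k ⧸ I) = 0 := by
    rw [← map_natCast (Ideal.Quotient.mk I)]
    exact Ideal.Quotient.eq_zero_iff_mem.2 (Ideal.mem_span_singleton_self _)
  let A : Rep.{u} k S := Rep.trivial k S (k ⧸ I)
  have hA : ∀ (g : S) (a : A), A.ρ g a = a := fun _ _ => rfl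
  let ν : S → ZMod n := fun g => (e g).toAdd
  have hν : ∀ g h, ν (g * h) = ν g + ν h := fun g h => by simp [ν]
  let g₀ : S := e.symm (Multiplicative.ofAdd 1)
  have hg₀ : ν g₀ = 1 := by simp [ν, g₀]
  have hpow : ∀ i : ℕ, ν (g₀ ^ i) = i := fun i => by
    induction i with
    | zero => simp [ν]
    | succ i ih => rw [pow_succ, hν, ih, hg₀]; push_cast; rfl
  let one : A := (1 : k ⧸ I)
  have hone : one ≠ 0 := one_ne_zero (α := k ⧸ I)
  rcases h.imp (fun h => h.subgroup S) fun h => h.subgroup S with h | h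
  · let c : ZMod n →+ (k ⧸ I) := ZMod.lift n ⟨Int.castAddHom (k ⧸ I), by simpa using hnI⟩
    have hc : c 1 = 1 := by
      have h1 := ZMod.lift_coe n (⟨Int.castAddHom (k ⧸ I), by simpa using hnI⟩ :
        {f : ℤ →+ (k ⧸ I) // f n = 0}) 1
      simpa [c] using h1
    let F : S → A →ₗ[k] (k ⧸ I) := fun g => LinearMap.mulLeft k (c (ν g))
    have hF : ∀ g a, F g a = c (ν g) * (a : k ⧸ I) := fun g a => rfl
    refine hone ?_
    have := h.cocycle_one_apply_eq_zero F (fun g h a => by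
      rw [hA, hF, hF, hF, hν, map_add, add_mul]) g₀ one (hA _ _)
    rw [hF, hg₀, hc, one_mul] at this
    exact this
  · let F : S × S → A →ₗ[k] A := fun p => (carry n (ν p.1) (ν p.2)) • LinearMap.id
    have hF : ∀ g h a, F (g, h) a = carry n (ν g) (ν h) • a := fun g h a => rfl
    -- The norm cycle $\sum_i [g_0^i\,|\,g_0]$: its boundary telescopes to $n[g_0]$, which vanishes
    -- in $k/n$.
    let x : S × S →₀ A := ∑ i ∈ Finset.range n, Finsupp.single (g₀ ^ i, g₀) one
    have hx : d₂₁ A x = 0 := by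
      have h1 : ∀ i : ℕ, d₂₁ A (Finsupp.single (g₀ ^ i, g₀) one) =
          Finsupp.single g₀ one - (Finsupp.single (g₀ ^ (i + 1)) one -
            Finsupp.single (g₀ ^ i) one) := fun i => by
        rw [d₂₁_single, hA, pow_succ]
        abel
      have hgn : g₀ ^ n = 1 := by rw [← hcard]; exact pow_card_eq_one'
      have h2 : n • one = 0 := by
        change n • (1 : k ⧸ I) = 0
        simpa using hnI
      rw [map_sum]
      simp only [h1]
      rw [Finset.sum_sub_distrib, Finset.sum_range_sub (fun i => Finsupp.single (g₀ ^ i) one),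
        hgn, pow_zero, sub_self, sub_zero, Finset.sum_const, Finset.card_range,
        Finsupp.smul_single, h2, Finsupp.single_zero]
    have := h.cocycle_two_apply_eq_zero F (fun g h j a => by
      rw [hA, hF, hF, hF, hF, hν, hν, ← sub_smul, ← add_smul, ← sub_smul, carry_cocycle,
        zero_smul]) x hx
    refine hone ?_
    rw [map_sum] at this
    simp only [Finsupp.lsum_single, hF, hpow, hg₀] at this
    rwa [← Finset.sum_smul, sum_carry, one_smul] at this

/-- By Cauchy's theorem every prime divisor of the order is the order of an element. -/
theorem SmallHomology.isUnit_natCard (h : SmallHomology k G) (B : Subgroup G) [Finite B] :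
    IsUnit ((Nat.card B : ℕ) : k) := by
  have key : ∀ m : ℕ, m ≠ 0 → (∀ p : ℕ, p.Prime → p ∣ m → IsUnit (p : k)) → IsUnit (m : k) := by
    intro m
    induction m using Nat.recOnMul with
    | zero => intro h; exact absurd rfl h
    | one => intros; simp
    | prime p hp => intro _ h; exact h p hp dvd_rfl
    | mul a b ha hb =>
      intro hab h
      rw [Nat.cast_mul]
      exact (ha (left_ne_zero_of_mul hab) fun p hp hd => h p hp (hd.mul_right b)).mul
        (hb (right_ne_zero_of_mul hab) fun p hp hd => h p hp (hd.mul_left a))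
  refine key _ Nat.card_pos.ne' fun p hp hd => ?_
  have : Fact p.Prime := ⟨hp⟩
  obtain ⟨x, hx⟩ := exists_prime_orderOf_dvd_card' p hd
  rw [← hx, ← Subgroup.orderOf_coe]
  refine h.isUnit_orderOf ?_
  rw [← orderOf_pos_iff, Subgroup.orderOf_coe, hx]
  exact hp.pos

end Torsion

/-! ### A mapping torus class in degree two -/

section Shift

variable {k G : Type u} [CommRing k] [Group G]

/-- The module of one-chains modulo the boundaries of the two-chains supported on pairs of elements
of the kernel of `θ`: the submodule divided out. -/
noncomputable def kerBoundaries (θ : G →* Multiplicative ℤ) (A : Rep.{u} k G) :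
    Submodule k (G →₀ A) :=
  (Finsupp.supported A k {p : G × G | θ p.1 = 1 ∧ θ p.2 = 1}).map (d₂₁ A).hom

section

variable {θ : G →* Multiplicative ℤ} {A : Rep.{u} k G}

theorem single_mul_mem_kerBoundaries {g h : G} (hg : θ g = 1) (hh : θ h = 1) (a : A) :
    Finsupp.single h (A.ρ g⁻¹ a) - Finsupp.single (g * h) a + Finsupp.single g a ∈
      kerBoundaries θ A :=
  ⟨Finsupp.single (g, h) a, Finsupp.single_mem_supported k a ⟨hg, hh⟩, d₂₁_single (g, h) a⟩

theorem single_pow_sub_mem_kerBoundaries {g : G} (hg : θ g = 1) (a : A) (n : ℕ) :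
    Finsupp.single (g ^ n) a - Finsupp.single g (∑ i ∈ Finset.range n, A.ρ (g⁻¹ ^ i) a) ∈
      kerBoundaries θ A := by
  induction n with
  | zero =>
    have := single_mul_mem_kerBoundaries (θ := θ) (map_one θ) (map_one θ) a
    simpa using this
  | succ n ih =>
    have := single_mul_mem_kerBoundaries (θ := θ) (g := g ^ n) (h := g) (by simp [hg]) hg a
    have h2 := sub_mem ih this
    rw [Finset.sum_range_succ, Finsupp.single_add]
    convert h2 using 1
    rw [pow_succ, ← inv_pow]
    abel

/-- Write $\beta=tbt^{-1}$. The transfer sums `hp` and `hq` and the relation `hrel` make the classes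
of $b\otimes m$ and $\beta\otimes tm$ agree inside $\ker\theta$, so conjugation by $t$ fixes the
class of $b\otimes m$. This class then suspends to a two-cycle, on which the product of the cocycle
`F` with $\theta$ takes the value `F b m`. -/
theorem not_smallHomology_of_shift {b t τ : G} {p q r : ℕ} (hb : θ b = 1)
    (ht : θ t = Multiplicative.ofAdd 1)
    (hrel : (t * b * t⁻¹) ^ q = b ^ p * τ) (hτ : τ ^ r = 1) (hr : IsUnit (r : k))
    {m m' : A} (hm : A.ρ b m = m) (hm' : A.ρ (b ^ p) m' = m') (hτm : A.ρ τ m' = m')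
    (hp : ∑ i ∈ Finset.range p, A.ρ (b⁻¹ ^ i) m' = m)
    (hq : ∑ i ∈ Finset.range q, A.ρ ((t * b * t⁻¹)⁻¹ ^ i) m' = A.ρ t m)
    (F : G → A →ₗ[k] k) (hF : ∀ g h a, F (g * h) a = F g a + F h (A.ρ g⁻¹ a))
    (hFb : F b m ≠ 0) : ¬ SmallHomology k G := by
  have hinv : ∀ (g : G) (a : A), A.ρ g a = a → A.ρ g⁻¹ a = a := fun g a h => by
    conv_lhs => rw [← h]
    simp
  rintro (h | h)
  · exact hFb (h.cocycle_one_apply_eq_zero F hF b m hm)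
  set β := t * b * t⁻¹ with hβ
  have hθβ : θ β = 1 := by simp [β, hb]
  have hθτ : θ τ = 1 := by
    have : τ = (b ^ p)⁻¹ * β ^ q := by rw [hrel]; group
    rw [this]; simp [hb, hθβ]
  have h1 := single_pow_sub_mem_kerBoundaries hb m' p
  have h2 := single_pow_sub_mem_kerBoundaries hθβ m' q
  rw [hp] at h1
  rw [hq] at h2
  have h3 := single_mul_mem_kerBoundaries (θ := θ) (g := b ^ p) (by simp [hb]) hθτ m'
  rw [hinv _ _ hm', ← hrel] at h3
  -- Since `τ` fixes `m'`, the chain $r[\tau]\otimes m'$ is homologous to $[\tau^r]\otimes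
  -- m'=[1]\otimes m'$, a boundary; and $r$ is a unit.
  have h4 : Finsupp.single τ m' ∈ kerBoundaries θ A := by
    have h5 := single_pow_sub_mem_kerBoundaries hθτ m' r
    have h6 : ∀ i, A.ρ (τ⁻¹ ^ i) m' = m' := fun i => by
      induction i with
      | zero => simp
      | succ i ih => rw [pow_succ, map_mul, Module.End.mul_apply, hinv _ _ hτm, ih]
    have h7 := single_pow_sub_mem_kerBoundaries (θ := θ) (map_one θ) m' 0
    simp only [h6, Finset.sum_const, Finset.card_range, hτ] at h5
    simp only [pow_zero, Finset.range_zero, Finset.sum_empty, Finsupp.single_zero, sub_zero] at h7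
    have h8 : (r : k) • Finsupp.single τ m' ∈ kerBoundaries θ A := by
      have := sub_mem h7 h5
      rw [sub_sub_cancel, ← Finsupp.smul_single, ← Nat.cast_smul_eq_nsmul k] at this
      exact this
    exact (Submodule.smul_mem_iff_of_isUnit _ hr).1 h8
  have h9 : Finsupp.single b m - Finsupp.single β (A.ρ t m) ∈ kerBoundaries θ A := by
    have := sub_mem (sub_mem h2 h1) (sub_mem h4 h3)
    convert this using 1
    abel
  obtain ⟨w, hw, hwd⟩ := h9
  -- The square $\beta t=tb$ of the torus; its boundary is opposite to that of `w`, so `w + y` is a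
  -- cycle.
  let y : G × G →₀ A := Finsupp.single (β, t) (A.ρ t m) - Finsupp.single (t, b) (A.ρ t m)
  have hβt : β * t = t * b := by simp [β]
  have hβm : A.ρ β⁻¹ (A.ρ t m) = A.ρ t m := by
    refine hinv _ _ ?_
    rw [← Module.End.mul_apply, ← map_mul, hβt, map_mul, Module.End.mul_apply, hm]
  have hy : d₂₁ A y = Finsupp.single β (A.ρ t m) - Finsupp.single b m := by
    rw [map_sub, d₂₁_single, d₂₁_single, hβm, hβt]
    simp only [Representation.inv_self_apply]
    abel
  have hFβ : F β (A.ρ t m) = F b m := by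
    have e1 := hF β t (A.ρ t m)
    have e2 := hF t b (A.ρ t m)
    rw [hβm, hβt, e2, Representation.inv_self_apply] at e1
    linear_combination -e1
  -- A product of `F` and `θ`. It vanishes on `w`, whose pairs lie in $\ker\theta$, and on `(t, b)`;
  -- only `(β, t)` contributes.
  let Φ : G × G → A →ₗ[k] k := fun p => (θ p.2).toAdd • F p.1
  have hΦ : ∀ g h a, Φ (g, h) a = (θ h).toAdd • F g a := fun g h a => rfl
  have := h.cocycle_two_apply_eq_zero Φ (fun g h j a => by
    simp only [hΦ, map_mul, toAdd_mul, add_smul, hF g h, smul_add]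
    abel) (w + y) (by
      have : d₂₁ A w = Finsupp.single b m - Finsupp.single β (A.ρ t m) := hwd
      rw [map_add, hy, this]; abel)
  have hΦw : Finsupp.lsum k Φ w = 0 := by
    rw [Finsupp.lsum_apply]
    refine Finset.sum_eq_zero fun p hp => ?_
    have := (hw : (w.support : Set (G × G)) ⊆ _) hp
    change (θ p.2).toAdd • F p.1 (w p) = 0
    rw [this.2]; simp
  rw [map_add, hΦw, map_sub, Finsupp.lsum_single, Finsupp.lsum_single, hΦ, hΦ, ht, hb, hFβ] at this
  exact hFb (by simpa using this)

end

end Shift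
end GroupDim

namespace GroupDim

/-! ### Locally finite functions on the rational line and flow through the origin -/

section LineModule

variable (k : Type u) [CommRing k]

/-- The functions on the rational line whose support meets each bounded interval in a finite
set. -/
def lineModule : Submodule k (ℚ → k) where
  carrier := {f | ∀ a b, {x | x ∈ Set.Icc a b ∧ f x ≠ 0}.Finite}
  zero_mem' a b := by simp
  add_mem' {f g} hf hg a b := ((hf a b).union (hg a b)).subset fun x hx => by
    by_cases h : f x = 0
    · exact Or.inr ⟨hx.1, fun h' => hx.2 (by simp [h, h'])⟩
    · exact Or.inl ⟨hx.1, h⟩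
  smul_mem' c f hf a b := (hf a b).subset fun x hx => ⟨hx.1, fun h => hx.2 (by simp [h])⟩

variable {k}

theorem comp_orderIso_mem_lineModule {f : ℚ → k} (hf : f ∈ lineModule k) (e : ℚ ≃o ℚ) :
    f ∘ e ∈ lineModule k := fun a b => by
  refine ((hf (e a) (e b)).preimage e.injective.injOn).subset fun x hx => ?_
  exact ⟨⟨e.monotone hx.1.1, e.monotone hx.1.2⟩, hx.2⟩

variable (k)

/-- The action of the order automorphisms of the rational line on `lineModule`. -/
def lineRep : Representation k (ℚ ≃o ℚ) (lineModule k) where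
  toFun e := ((LinearMap.funLeft k k (e⁻¹ : ℚ ≃o ℚ)).comp (lineModule k).subtype).codRestrict _
    fun f => comp_orderIso_mem_lineModule f.2 _
  map_one' := rfl
  map_mul' _ _ := rfl

variable {k}

theorem lineRep_apply (e : ℚ ≃o ℚ) (f : lineModule k) (x : ℚ) :
    (lineRep k e f : ℚ → k) x = (f : ℚ → k) (e⁻¹ x) := rfl

variable (k)

/-- The indicator function of the negative half line. -/
noncomputable def negInd (x : ℚ) : k := if x < 0 then 1 else 0

variable {k}

/-- The indicators of $x<e(0)$ and of $x<0$ differ only between $0$ and $e(0)$, a bounded interval.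
-/
theorem finite_support_flow (e : ℚ ≃o ℚ) (f : lineModule k) :
    (Function.support fun x => (f : ℚ → k) x * (negInd k (e⁻¹ x) - negInd k x)).Finite := by
  have h := f.2 (min 0 (e 0)) (max 0 (e 0))
  refine h.subset fun x hx => ?_
  rw [Function.mem_support] at hx
  refine ⟨?_, left_ne_zero_of_mul hx⟩
  have h2 := right_ne_zero_of_mul hx
  have h3 : e⁻¹ x < 0 ↔ x < e 0 := by
    rw [← e.lt_iff_lt]
    simp
  simp only [negInd, h3] at h2
  by_contra hc
  simp only [Set.mem_Icc, inf_le_iff, le_sup_iff, not_and_or, not_or, not_le] at hc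
  rcases hc with hc | hc
  · simp [hc.1, hc.2] at h2
  · simp [hc.1.not_gt, hc.2.not_gt] at h2

variable (k)

/-- The mass that an order automorphism of the line moves across the origin. -/
noncomputable def flow (e : ℚ ≃o ℚ) : lineModule k →ₗ[k] k where
  toFun f := ∑ᶠ x, (f : ℚ → k) x * (negInd k (e⁻¹ x) - negInd k x)
  map_add' f g := by
    rw [← finsum_add_distrib (finite_support_flow e f) (finite_support_flow e g)]
    exact finsum_congr fun x => add_mul _ _ _
  map_smul' c f := by
    rw [RingHom.id_apply, smul_finsum' c (finite_support_flow e f)]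
    exact finsum_congr fun x => mul_assoc _ _ _

variable {k}

/-- After reindexing the second sum by `g`, the differences of indicators telescope. -/
theorem flow_mul (g h : ℚ ≃o ℚ) (f : lineModule k) :
    flow k (g * h) f = flow k g f + flow k h (lineRep k g⁻¹ f) := by
  have h1 : flow k h (lineRep k g⁻¹ f) =
      ∑ᶠ x, (f : ℚ → k) x * (negInd k (h⁻¹ (g⁻¹ x)) - negInd k (g⁻¹ x)) := by
    rw [← finsum_comp_equiv g.toEquiv]
    refine finsum_congr fun x => ?_
    rw [lineRep_apply, inv_inv]
    change _ = (f : ℚ → k) (g x) * (negInd k (h⁻¹ (g⁻¹ (g x))) - negInd k (g⁻¹ (g x)))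
    rw [show g⁻¹ (g x) = x from g.symm_apply_apply x]
  have h2 : (Function.support fun x => (f : ℚ → k) x *
      (negInd k (h⁻¹ (g⁻¹ x)) - negInd k (g⁻¹ x))).Finite := by
    refine ((finite_support_flow (g * h) f).union (finite_support_flow g f)).subset fun x hx => ?_
    by_contra hc
    simp only [Set.mem_union, Function.mem_support, not_or, not_not] at hc
    refine hx ?_
    have := congrArg₂ (· - ·) hc.1 hc.2
    rw [sub_zero] at this
    rw [← this]
    change _ = (f : ℚ → k) x * (negInd k (h⁻¹ (g⁻¹ x)) - negInd k x) - _
    ring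
  rw [h1]
  change ∑ᶠ x, _ = ∑ᶠ x, _ + _
  rw [← finsum_add_distrib (finite_support_flow g f) h2]
  refine finsum_congr fun x => ?_
  change (f : ℚ → k) x * (negInd k (h⁻¹ (g⁻¹ x)) - negInd k x) = _
  ring

open Classical in
variable (k) in
/-- The indicator function of the integers. -/
noncomputable def intInd (x : ℚ) : k := if ∃ z : ℤ, (z : ℚ) = x then 1 else 0

theorem intInd_intCast (z : ℤ) : intInd k z = 1 := if_pos ⟨z, rfl⟩

theorem intInd_of_not {x : ℚ} (h : ¬ ∃ z : ℤ, (z : ℚ) = x) : intInd k x = 0 := if_neg h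

theorem intInd_mem_lineModule : intInd k ∈ lineModule k := fun a b => by
  refine ((Set.finite_Icc ⌈a⌉ ⌊b⌋).image (Int.cast : ℤ → ℚ)).subset fun x hx => ?_
  obtain ⟨z, rfl⟩ : ∃ z : ℤ, (z : ℚ) = x := by
    by_contra h
    exact hx.2 (intInd_of_not h)
  exact ⟨z, ⟨Int.ceil_le.2 hx.1.1, Int.le_floor.2 hx.1.2⟩, rfl⟩

/-- For an integer $y$ exactly one of $y,\dots,y+n-1$ is divisible by $n$, at index $(-y)\bmod n$;
for other $y$ none is. Thus $n$ translates of the lattice $n\mathbb Z$ tile $\mathbb Z$. -/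
theorem sum_intInd_div {n : ℕ} (hn : 0 < n) (y : ℚ) :
    ∑ i ∈ Finset.range n, intInd k ((y + i) / n) = intInd k y := by
  have hn' : (n : ℚ) ≠ 0 := by positivity
  have hnz : (n : ℤ) ≠ 0 := by positivity
  by_cases h : ∃ z : ℤ, (z : ℚ) = y
  · obtain ⟨z, rfl⟩ := h
    rw [intInd_intCast]
    have hm0 := Int.emod_nonneg (-z) hnz
    have hml := Int.emod_lt_of_pos (-z) (by positivity : (0 : ℤ) < n)
    rw [Finset.sum_eq_single_of_mem ((-z) % n).toNat (by rw [Finset.mem_range]; omega)]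
    · have : ((z : ℚ) + (((-z) % n).toNat : ℕ)) / n = ((-((-z) / n) : ℤ) : ℚ) := by
        rw [div_eq_iff hn']
        have h1 : ((((-z) % n).toNat : ℕ) : ℤ) = (-z) % n := Int.toNat_of_nonneg hm0
        have h2 := Int.emod_add_mul_ediv (-z) n
        have : z + ((((-z) % n).toNat : ℕ) : ℤ) = -((-z) / n) * n := by rw [h1]; linarith
        exact_mod_cast this
      rw [this, intInd_intCast]
    · intro i hi hne
      refine intInd_of_not ?_
      rintro ⟨w, hw⟩
      rw [eq_div_iff hn'] at hw
      have hw' : w * n = z + i := by exact_mod_cast hw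
      refine hne ?_
      rw [Finset.mem_range] at hi
      have : (-z) % n = i := by
        have : -z = i + n * (-w) := by linarith
        rw [this, Int.add_mul_emod_self_left]
        exact Int.emod_eq_of_lt (by positivity) (by exact_mod_cast hi)
      omega
  · rw [intInd_of_not h]
    refine Finset.sum_eq_zero fun i _ => intInd_of_not ?_
    rintro ⟨w, hw⟩
    rw [eq_div_iff hn'] at hw
    exact h ⟨w * n - i, by push_cast; linarith⟩

theorem flow_addRight_one_intInd :
    flow k (OrderIso.addRight 1) ⟨intInd k, intInd_mem_lineModule⟩ = 1 := by
  change ∑ᶠ x, intInd k x * (negInd k ((OrderIso.addRight (1 : ℚ)).symm x) - negInd k x) = 1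
  rw [finsum_eq_single _ (0 : ℚ)]
  · have := intInd_intCast (k := k) 0
    rw [Int.cast_zero] at this
    simp [negInd, this]
  · intro x hx
    by_cases h : ∃ z : ℤ, (z : ℚ) = x
    · obtain ⟨z, rfl⟩ := h
      have : ((OrderIso.addRight (1 : ℚ)).symm z < 0) ↔ (z : ℚ) < 0 := by
        have h0 : z ≠ 0 := by rintro rfl; simp at hx
        simp only [OrderIso.addRight_symm, OrderIso.addRight_apply]
        have : (z : ℚ) + -1 = ((z - 1 : ℤ) : ℚ) := by push_cast; ring
        rw [this]
        simp only [Int.cast_lt_zero]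
        omega
      rw [negInd, negInd, if_congr this rfl rfl, sub_self, mul_zero]
    · rw [intInd_of_not h, zero_mul]

/-- A group acting on the rational line by increasing affine maps, in which the unit translation
`b` and the homothety `t` are related by `(t b t⁻¹) ^ q = b ^ p τ`, has non-zero homology in degrees
one and two. -/
theorem not_smallHomology_of_affine {G : Type u} [Group G] [Nontrivial k] (α : G →* (ℚ ≃o ℚ))
    {θ : G →* Multiplicative ℤ} {b t τ : G} {p q r : ℕ} (hp : 0 < p) (hq : 0 < q) (hb : θ b = 1)
    (ht : θ t = Multiplicative.ofAdd 1)
    (hrel : (t * b * t⁻¹) ^ q = b ^ p * τ) (hτ : τ ^ r = 1) (hr : IsUnit (r : k))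
    (hαb : ∀ x, α b x = x + 1) (hαt : ∀ x, α t x = (p / q : ℚ) * x) : ¬ SmallHomology k G := by
  have hp' : (p : ℚ) ≠ 0 := by positivity
  have hq' : (q : ℚ) ≠ 0 := by positivity
  have hpow : ∀ (g : G) (c : ℚ), (∀ x, α g x = x + c) → ∀ (i : ℕ) x, α (g ^ i) x = x + i * c := by
    intro g c h i
    induction i with
    | zero => simp
    | succ i ih =>
      intro x
      rw [pow_succ, map_mul, RelIso.mul_apply, h, ih]
      push_cast; ring
  have hαt' : ∀ x, α t⁻¹ x = (q / p : ℚ) * x := fun x => by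
    apply (α t).injective
    rw [← RelIso.mul_apply, ← map_mul, mul_inv_cancel, map_one, hαt, RelIso.one_apply]
    field_simp
  have hβ : ∀ x, α (t * b * t⁻¹) x = x + p / q := fun x => by
    rw [map_mul, map_mul, RelIso.mul_apply, RelIso.mul_apply, hαt', hαb, hαt]
    field_simp
  have hατ : ∀ x, α τ x = x := fun x => by
    apply (α (b ^ p)).injective
    rw [← RelIso.mul_apply, ← map_mul, ← hrel, hpow _ _ hβ, hpow _ _ hαb]
    field_simp
  let A : Rep.{u} k G := Rep.of ((lineRep k).comp α)
  -- `m` is the indicator of $\mathbb Z$ and `m'` that of $p\mathbb Z$. The $p$ translates of `m'`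
  -- by steps of $1$ add up to `m`; its $q$ translates by steps of $p/q$ add up to the indicator of
  -- $(p/q)\mathbb Z$, which is $t\,m$.
  let m : A := (⟨intInd k, intInd_mem_lineModule⟩ : lineModule k)
  let s : ℚ ≃o ℚ := OrderIso.mulRight₀ (p : ℚ)⁻¹ (by positivity)
  let m' : A := (⟨intInd k ∘ s, comp_orderIso_mem_lineModule intInd_mem_lineModule s⟩ :
    lineModule k)
  have hA : ∀ (g : G) (f : A) x, (A.ρ g f : lineModule k).1 x = (f : lineModule k).1 (α g⁻¹ x) := by
    intro g f x
    rw [map_inv]; rfl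
  have hm' : ∀ x, (m' : lineModule k).1 x = intInd k (x / p) := fun x => rfl
  have hαinv : ∀ (g : G) (c : ℚ), (∀ x, α g x = x + c) → ∀ x, α g⁻¹ x = x - c := by
    intro g c h x
    apply (α g).injective
    rw [← RelIso.mul_apply, ← map_mul, mul_inv_cancel, map_one, h, RelIso.one_apply]
    ring
  have hext : ∀ f f' : A, (∀ x, (f : lineModule k).1 x = (f' : lineModule k).1 x) → f = f' :=
    fun f f' h => Subtype.ext (funext h)
  have hshift : ∀ x : ℚ, intInd k (x - 1) = intInd k x := fun x => by
    have h1 := sum_intInd_div (k := k) one_pos (x - 1)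
    by_cases h : ∃ z : ℤ, (z : ℚ) = x
    · obtain ⟨z, rfl⟩ := h
      have : (z : ℚ) - 1 = ((z - 1 : ℤ) : ℚ) := by push_cast; rfl
      rw [this, intInd_intCast, intInd_intCast]
    · rw [intInd_of_not h, intInd_of_not]
      rintro ⟨z, hz⟩
      exact h ⟨z + 1, by push_cast; linarith⟩
  have hsum : ∀ (n : ℕ) (φ : ℕ → A) x, (∑ i ∈ Finset.range n, φ i : lineModule k).1 x =
      ∑ i ∈ Finset.range n, (φ i : lineModule k).1 x := fun n φ x => by
    rw [Submodule.coe_sum, Finset.sum_apply]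
  refine not_smallHomology_of_shift (A := A) (m := m) (m' := m') hb ht hrel hτ hr ?_ ?_ ?_ ?_ ?_
    (fun g => flow k (α g)) (fun g h a => ?_) ?_
  · refine hext _ _ fun x => ?_
    rw [hA, hαinv b 1 hαb]
    exact hshift x
  · refine hext _ _ fun x => ?_
    rw [hA, hαinv _ _ (hpow b 1 hαb p), hm', hm', mul_one, sub_div, div_self hp', hshift]
  · refine hext _ _ fun x => ?_
    rw [hA, hαinv τ 0 (by simpa using hατ), sub_zero]
  · refine hext _ _ fun x => ?_
    refine (hsum _ _ _).trans ?_
    refine (Finset.sum_congr rfl fun i _ => ?_).trans (sum_intInd_div hp x)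
    rw [hA, inv_pow, inv_inv, hpow b 1 hαb, hm', mul_one]
  · refine hext _ _ fun x => ?_
    refine (hsum _ _ _).trans ?_
    rw [hA, hαt']
    refine (Finset.sum_congr rfl fun i _ => ?_).trans (sum_intInd_div hq (q / p * x : ℚ))
    rw [hA, inv_pow, inv_inv, hpow _ _ hβ, hm']
    congr 1
    field_simp
  · rw [map_mul, flow_mul, ← map_inv]; rfl
  · have : α b = OrderIso.addRight 1 := by ext x; exact hαb x
    rw [this]
    change flow k (OrderIso.addRight 1) ⟨intInd k, intInd_mem_lineModule⟩ ≠ 0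
    rw [flow_addRight_one_intInd]
    exact one_ne_zero

end LineModule
end GroupDim

namespace GroupDim

open groupCohomology

/-! ### Splitting extensions: one-edge groups have `cd` at most one -/

section CocycleExtension

variable {k G : Type u} [CommRing k] [Group G] {A : Rep.{u} k G}

/-- The extension of `G` by `A` determined by a two-cocycle. -/
@[ext]
structure CocycleExt (f : cocycles₂ A) where
  /-- The component in the coefficients. -/
  fst : A
  /-- The component in the group. -/
  snd : G

namespace CocycleExt

variable {f : cocycles₂ A}

instance : Mul (CocycleExt f) :=
  ⟨fun x y => ⟨x.fst + A.ρ x.snd y.fst + f (x.snd, y.snd), x.snd * y.snd⟩⟩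

/-- Cocycles are not normalized, which accounts for the terms `f (1, 1)` here and in the inverse. -/
instance : One (CocycleExt f) := ⟨⟨-f (1, 1), 1⟩⟩

instance : Inv (CocycleExt f) :=
  ⟨fun x => ⟨-A.ρ x.snd⁻¹ x.fst - f (x.snd⁻¹, x.snd) - f (1, 1), x.snd⁻¹⟩⟩

@[simp] theorem mul_fst (x y : CocycleExt f) :
    (x * y).fst = x.fst + A.ρ x.snd y.fst + f (x.snd, y.snd) := rfl
@[simp] theorem mul_snd (x y : CocycleExt f) : (x * y).snd = x.snd * y.snd := rfl
@[simp] theorem one_fst : (1 : CocycleExt f).fst = -f (1, 1) := rfl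
@[simp] theorem one_snd : (1 : CocycleExt f).snd = 1 := rfl
@[simp] theorem inv_fst (x : CocycleExt f) :
    x⁻¹.fst = -A.ρ x.snd⁻¹ x.fst - f (x.snd⁻¹, x.snd) - f (1, 1) := rfl
@[simp] theorem inv_snd (x : CocycleExt f) : x⁻¹.snd = x.snd⁻¹ := rfl

instance : Group (CocycleExt f) :=
  Group.ofLeftAxioms
    (fun x y z => by
      have h := (mem_cocycles₂_iff (f : G × G → A)).1 f.2 x.snd y.snd z.snd
      refine CocycleExt.ext ?_ (mul_assoc _ _ _)
      simp only [mul_fst, mul_snd, map_add, map_mul, Module.End.mul_apply]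
      refine sub_eq_zero.1 (Eq.trans ?_ (sub_eq_zero.2 h))
      abel)
    (fun x => by
      refine CocycleExt.ext ?_ (one_mul _)
      simp only [mul_fst, one_fst, one_snd, map_one, Module.End.one_apply, cocycles₂_map_one_fst]
      abel)
    (fun x => by
      refine CocycleExt.ext ?_ (inv_mul_cancel _)
      simp only [mul_fst, inv_fst, inv_snd, one_fst]
      abel)

variable (f) in
/-- The projection of the extension to the group. -/
def proj : CocycleExt f →* G where
  toFun := snd
  map_one' := rfl
  map_mul' _ _ := rfl

@[simp] theorem proj_apply (x : CocycleExt f) : proj f x = x.snd := rfl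

/-- Summing the cocycle identity over its last variable exhibits $|B|\cdot f$ as a coboundary, and
$|B|$ is invertible. -/
theorem exists_lift_of_finite {B : Type*} [Group B] [Finite B] (hB : IsUnit (Nat.card B : k))
    (j : B →* G) : ∃ s : B →* CocycleExt f, (proj f).comp s = j := by
  have := Fintype.ofFinite B
  obtain ⟨u, hu⟩ := hB
  let F : B → A := fun b => ∑ c, f (j b, j c)
  have hF : ∀ b c, F (b * c) + (u : k) • f (j b, j c) = F b + A.ρ (j b) (F c) := by
    intro b c
    have h := fun d => (mem_cocycles₂_iff (f : G × G → A)).1 f.2 (j b) (j c) (j d)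
    have h1 := Finset.sum_congr (rfl : Finset.univ = Finset.univ) fun d (_ : d ∈ _) => h d
    rw [Finset.sum_add_distrib, Finset.sum_add_distrib, ← map_sum (A.ρ (j b)), Finset.sum_const,
      Finset.card_univ, ← Nat.card_eq_fintype_card, ← Nat.cast_smul_eq_nsmul k, ← hu] at h1
    have h2 : ∑ d, f (j b, j c * j d) = F b :=
      Fintype.sum_equiv (Equiv.mulLeft c) _ _ fun d => by simp
    rw [h2] at h1
    simpa only [F, map_mul, add_comm (F b)] using h1
  have hmul : ∀ b c, -((↑u⁻¹ : k) • F (b * c)) =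
      -((↑u⁻¹ : k) • F b) + A.ρ (j b) (-((↑u⁻¹ : k) • F c)) + f (j b, j c) := by
    intro b c
    have h1 := congrArg (fun x => (↑u⁻¹ : k) • x) (hF b c)
    simp only [smul_add, smul_smul, Units.inv_mul, one_smul] at h1
    rw [map_neg, map_smul]
    refine sub_eq_zero.1 (Eq.trans ?_ (sub_eq_zero.2 h1.symm))
    abel
  refine ⟨MonoidHom.mk' (fun b => ⟨-((↑u⁻¹ : k) • F b), j b⟩) fun b c =>
    CocycleExt.ext (hmul b c) (map_mul j b c), ?_⟩
  ext b
  rfl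

/-- Two lifts differ by a one-cocycle `z`, which averaging makes a coboundary. The conjugating
element lies over 1 and is the negative average of `z`, corrected by `-f (1, 1)`. -/
theorem exists_conj_of_finite {C : Type*} [Group C] [Finite C] (hC : IsUnit (Nat.card C : k))
    (s s' : C →* CocycleExt f) (h : ∀ c, (s c).snd = (s' c).snd) :
    ∃ e : CocycleExt f, e.snd = 1 ∧ ∀ c, e * s c = s' c * e := by
  have := Fintype.ofFinite C
  obtain ⟨u, hu⟩ := hC
  let z : C → A := fun c => (s c).fst - (s' c).fst
  have hz : ∀ c d, z (c * d) = z c + A.ρ (s c).snd (z d) := by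
    intro c d
    simp only [z, map_mul, mul_fst, map_sub, h]
    abel
  let Z : A := ∑ d, z d
  have hZ : ∀ c, Z = (u : k) • z c + A.ρ (s c).snd Z := by
    intro c
    have h1 : ∑ d, z (c * d) = Z := Fintype.sum_equiv (Equiv.mulLeft c) _ _ fun d => rfl
    simp only [hz] at h1
    rw [Finset.sum_add_distrib, ← map_sum, Finset.sum_const,
      Finset.card_univ, ← Nat.card_eq_fintype_card, ← Nat.cast_smul_eq_nsmul k, ← hu] at h1
    exact h1.symm
  refine ⟨⟨-((↑u⁻¹ : k) • Z) - f (1, 1), 1⟩, rfl, fun c => CocycleExt.ext ?_ ?_⟩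
  · have h1 := congrArg (fun x => (↑u⁻¹ : k) • x) (hZ c)
    simp only [smul_add, smul_smul, Units.inv_mul, one_smul] at h1
    simp only [mul_fst, map_one, Module.End.one_apply, ← h]
    rw [cocycles₂_map_one_fst f (s c).snd, cocycles₂_map_one_snd f (s c).snd, map_sub,
      map_neg, map_smul]
    simp only [z] at h1
    refine sub_eq_zero.1 (Eq.trans ?_ (sub_eq_zero.2 h1.symm))
    abel
  · simp [h]

end CocycleExt

open CocycleExt

/-- The coefficient part of a splitting is, up to sign, a cochain bounding `f`. -/
theorem cd_le_one_of_splits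
    (h : ∀ (A : Rep.{u} k G) (f : cocycles₂ A), ∃ σ : G →* CocycleExt f,
      (proj f).comp σ = MonoidHom.id G) : cd k G ≤ 1 := by
  refine iInf₂_le 1 fun A => ModuleCat.isZero_iff_subsingleton.2 ⟨fun x y => ?_⟩
  have key : ∀ x : groupCohomology A 2, x = 0 := fun x => by
    induction x using H2_induction_on with
    | h f =>
    rw [H2π_eq_zero_iff]
    obtain ⟨σ, hσ⟩ := h A f
    have hs : ∀ g, (σ g).snd = g := fun g => DFunLike.congr_fun hσ g
    refine ⟨fun g => -(σ g).fst, ?_⟩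
    ext ⟨g, h⟩
    have h1 := congrArg CocycleExt.fst (map_mul σ g h)
    rw [mul_fst, hs, hs] at h1
    change A.ρ g (-(σ h).fst) - -(σ (g * h)).fst + -(σ g).fst = f (g, h)
    rw [h1, map_neg]
    abel
  rw [key x, key y]

/-- Lift the vertex group by averaging. An arbitrary lift `t` of the stable letter satisfies the HNN
relations only up to a change of lift on `C`; the conjugating element `e` absorbs the discrepancy,
and `e * t` is the right lift. -/
theorem cd_le_one_of_mulEquiv_hnnExtension {B : Type u} [Group B] [Finite B]
    (hB : IsUnit (Nat.card B : k)) (C D : Subgroup B) (φ : C ≃* D)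
    (ε : G ≃* HNNExtension B C D φ) : cd k G ≤ 1 := by
  refine cd_le_one_of_splits fun A f => ?_
  let j : HNNExtension B C D φ →* G := ε.symm
  suffices ∃ σ, (proj f).comp σ = j by
    obtain ⟨σ, hσ⟩ := this
    refine ⟨σ.comp ε.toMonoidHom, ?_⟩
    rw [← MonoidHom.comp_assoc, hσ]
    ext x
    exact ε.symm_apply_apply x
  obtain ⟨s, hs⟩ := exists_lift_of_finite (f := f) hB (j.comp HNNExtension.of)
  have hs' : ∀ b, (s b).snd = j (HNNExtension.of b) := fun b => DFunLike.congr_fun hs b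
  have hC : IsUnit (Nat.card C : k) :=
    isUnit_of_dvd_unit (Nat.cast_dvd_cast C.card_subgroup_dvd_card) hB
  let t : CocycleExt f := ⟨0, j HNNExtension.t⟩
  let s₁ : C →* CocycleExt f := (MulAut.conj t).toMonoidHom.comp (s.comp C.subtype)
  let s₂ : C →* CocycleExt f := s.comp (D.subtype.comp φ.toMonoidHom)
  obtain ⟨e, he, hes⟩ := exists_conj_of_finite hC s₁ s₂ fun c => by
    simp [s₁, s₂, hs', t, HNNExtension.equiv_eq_conj]
  refine ⟨HNNExtension.lift s (e * t) fun a => ?_, ?_⟩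
  · have := hes a
    simp only [s₁, s₂, MonoidHom.comp_apply, MulEquiv.coe_toMonoidHom, MulAut.conj_apply,
      Subgroup.coe_subtype] at this
    calc e * t * s a = e * (t * s a * t⁻¹) * t := by group
      _ = _ := by rw [this, mul_assoc]
  · refine HNNExtension.hom_ext ?_ ?_
    · ext b; simp [hs']
    · simp [he, t]

/-- Lifts of the two vertex groups agree on `C` up to conjugation over 1; conjugating the first of
them makes them glue. -/
theorem cd_le_one_of_mulEquiv_pushoutI {C : Type u} [Group C] {B : Fin 2 → Type u}
    [∀ i, Group (B i)]
    [∀ i, Finite (B i)] (hB : ∀ i, IsUnit (Nat.card (B i) : k)) (φ : ∀ i, C →* B i)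
    (hφ : ∀ i, Function.Injective (φ i)) (ε : G ≃* Monoid.PushoutI φ) : cd k G ≤ 1 := by
  refine cd_le_one_of_splits fun A f => ?_
  let j : Monoid.PushoutI φ →* G := ε.symm
  suffices ∃ σ, (proj f).comp σ = j by
    obtain ⟨σ, hσ⟩ := this
    refine ⟨σ.comp ε.toMonoidHom, ?_⟩
    rw [← MonoidHom.comp_assoc, hσ]
    ext x
    exact ε.symm_apply_apply x
  choose s hs using fun i => exists_lift_of_finite (f := f) (hB i)
    (j.comp (Monoid.PushoutI.of (φ := φ) i))
  have hs' : ∀ i b, (s i b).snd = j (Monoid.PushoutI.of i b) := fun i b =>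
    DFunLike.congr_fun (hs i) b
  have : Finite C := Finite.of_injective _ (hφ 0)
  have hC : IsUnit (Nat.card C : k) :=
    isUnit_of_dvd_unit (Nat.cast_dvd_cast (Subgroup.card_dvd_of_injective _ (hφ 0))) (hB 0)
  obtain ⟨e, he, hes⟩ := exists_conj_of_finite hC ((s 0).comp (φ 0)) ((s 1).comp (φ 1)) fun c => by
    simp only [MonoidHom.comp_apply, hs', Monoid.PushoutI.of_apply_eq_base]
  let s' : ∀ i, B i →* CocycleExt f :=
    fun i => if i = 0 then (MulAut.conj e).toMonoidHom.comp (s i) else s i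
  refine ⟨Monoid.PushoutI.lift s' ((s 1).comp (φ 1)) fun i => ?_, ?_⟩
  · fin_cases i
    · ext1 c
      have := hes c
      simp only [MonoidHom.comp_apply] at this
      simp [s', this]
    · rfl
  · refine Monoid.PushoutI.hom_ext_nonempty fun i => ?_
    fin_cases i
    · ext b; simp [s', hs', he]
    · ext b; simp [s', hs']

end CocycleExtension
end GroupDim

namespace GroupDim

/-! ### Locally finite by dihedral groups -/

section LocallyFinite

variable {G H : Type*} [Group G] [Group H]

variable (G) in
/-- Every finitely generated subgroup is finite. -/
def IsLocallyFinite : Prop := ∀ K : Subgroup G, K.FG → Finite K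

theorem fg_map {K : Subgroup G} (hK : K.FG) (f : G →* H) : (K.map f).FG := by
  obtain ⟨S, rfl, hS⟩ := (Subgroup.fg_iff _).1 hK
  exact (Subgroup.fg_iff _).2 ⟨f '' S, (MonoidHom.map_closure f S).symm, hS.image f⟩

theorem fg_zpowers (x : G) : (Subgroup.zpowers x).FG :=
  (Subgroup.fg_iff _).2 ⟨{x}, (Subgroup.zpowers_eq_closure x).symm, Set.finite_singleton x⟩

theorem IsLocallyFinite.of_injective (hG : IsLocallyFinite G) {f : H →* G}
    (hf : Function.Injective f) : IsLocallyFinite H := fun K hK => by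
  have := hG _ (fg_map hK f)
  exact Finite.of_equiv _ (K.equivMapOfInjective f hf).symm.toEquiv

theorem IsLocallyFinite.of_finite [Finite G] : IsLocallyFinite G := fun _ _ => inferInstance

theorem IsLocallyFinite.finite (hG : IsLocallyFinite G) [h : Group.FG G] : Finite G := by
  have := hG ⊤ (Group.fg_def.1 h)
  exact Finite.of_equiv _ Subgroup.topEquiv.toEquiv

theorem fg_inf_of_finiteIndex {K : Subgroup G} (hK : K.FG) (N : Subgroup G) [N.FiniteIndex] :
    (K ⊓ N).FG := by
  have : Group.FG K := (Group.fg_iff_subgroup_fg K).2 hK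
  have h := (Group.fg_iff_subgroup_fg _).1 (Subgroup.fg_of_index_ne_zero (N.subgroupOf K))
  rw [inf_comm, ← Subgroup.subgroupOf_map_subtype]
  exact fg_map h _

theorem finite_of_finite_inf {K : Subgroup G} (N : Subgroup G) [N.FiniteIndex]
    (h : Finite (K ⊓ N : Subgroup G)) : Finite K := by
  have : Finite (N.subgroupOf K) := by
    rw [inf_comm, ← Subgroup.subgroupOf_map_subtype] at h
    exact Finite.of_equiv _ ((N.subgroupOf K).equivMapOfInjective K.subtype
      K.subtype_injective).symm.toEquiv
  exact Finite.of_equiv _ (Subgroup.groupEquivQuotientProdSubgroup (s := N.subgroupOf K)).symm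

theorem IsLocallyFinite.of_finiteIndex (N : Subgroup G) [N.FiniteIndex] (hN : IsLocallyFinite N) :
    IsLocallyFinite G := fun K hK => by
  refine finite_of_finite_inf N ?_
  have h1 := hN ((K ⊓ N).subgroupOf N) ?_
  · exact Finite.of_equiv _ (Subgroup.subgroupOfEquivOfLe inf_le_right).toEquiv
  · have := (Group.fg_iff_subgroup_fg _).2 (fg_inf_of_finiteIndex hK N)
    exact (Group.fg_iff_subgroup_fg _).1
      (Group.fg_of_surjective (f := (Subgroup.subgroupOfEquivOfLe
        (inf_le_right : K ⊓ N ≤ N)).symm.toMonoidHom) (MulEquiv.surjective _))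

variable (G) in
/-- `G` acts on the integers by isometries with locally finite kernel: there are a sign character
`χ` and a `χ`-twisted cocycle `c` whose common kernel is locally finite. -/
def IsLocallyFiniteByDihedral : Prop :=
  ∃ (χ : G →* ℤˣ) (c : G → ℤ), (∀ g h, c (g * h) = c g + χ g * c h) ∧
    ∀ K : Subgroup G, K.FG → (∀ g ∈ K, χ g = 1 ∧ c g = 0) → Finite K

theorem IsLocallyFinite.isLocallyFiniteByDihedral (hG : IsLocallyFinite G) :
    IsLocallyFiniteByDihedral G :=
  ⟨1, 0, by simp, fun K hK _ => hG K hK⟩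

theorem IsLocallyFiniteByDihedral.of_injective (hG : IsLocallyFiniteByDihedral G) {f : H →* G}
    (hf : Function.Injective f) : IsLocallyFiniteByDihedral H := by
  obtain ⟨χ, c, hc, h⟩ := hG
  refine ⟨χ.comp f, c ∘ f, fun g g' => by simp [hc], fun K hK hK' => ?_⟩
  have := h _ (fg_map hK f) (by rintro _ ⟨g, hg, rfl⟩; exact hK' g hg)
  exact Finite.of_equiv _ (K.equivMapOfInjective f hf).symm.toEquiv

/-- The zeros of `ℓ` in `N` are the torsion elements of `N`, a condition stable under conjugation,
so `G` acts on the infinite cyclic image of `ℓ` by a sign `χ`. A sum over the cosets, as in the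
transfer, extends `ℓ` to a `χ`-twisted cocycle on `G`, up to the factor $[G:N]$; this leaves the
kernel inside `N` unchanged. -/
theorem IsLocallyFiniteByDihedral.of_normal_finiteIndex (N : Subgroup G) [N.Normal] [N.FiniteIndex]
    (ℓ : G → ℤ) (hℓ : ∀ x ∈ N, ∀ y ∈ N, ℓ (x * y) = ℓ x + ℓ y)
    (h : ∀ K : Subgroup G, K.FG → (∀ g ∈ K, g ∈ N ∧ ℓ g = 0) → Finite K) :
    IsLocallyFiniteByDihedral G := by
  let l : N →* Multiplicative ℤ := MonoidHom.mk' (fun x => Multiplicative.ofAdd (ℓ x)) fun x y => by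
    simp [hℓ x x.2 y y.2]
  have hl : ∀ x : N, (l x).toAdd = ℓ x := fun x => rfl
  have h1 : ℓ 1 = 0 := by simpa using hℓ 1 N.one_mem 1 N.one_mem
  have hz : ∀ x ∈ N, ∀ m : ℤ, ℓ (x ^ m) = m * ℓ x := fun x hx m => by
    have := congrArg Multiplicative.toAdd (map_zpow l ⟨x, hx⟩ m)
    rwa [toAdd_zpow, hl, hl, smul_eq_mul, Subgroup.coe_zpow] at this
  obtain ⟨⟨_, x₀, rfl⟩, hgen⟩ := (inferInstance : IsCyclic l.range).exists_generator
  have hdvd : ∀ x : N, ∃ m : ℤ, ℓ x = m * ℓ x₀ := fun x => by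
    obtain ⟨m, hm⟩ := hgen ⟨l x, x, rfl⟩
    refine ⟨m, ?_⟩
    have := congrArg (fun y => (y.1 : Multiplicative ℤ).toAdd) hm
    simpa [hl] using this.symm
  have hfin : ∀ x ∈ N, ℓ x = 0 ↔ IsOfFinOrder x := by
    intro x hx
    constructor
    · intro h0
      have hz' : ∀ g ∈ Subgroup.zpowers x, g ∈ N ∧ ℓ g = 0 := by
        rintro _ ⟨m, rfl⟩
        exact ⟨N.zpow_mem hx m, by rw [hz x hx, h0, mul_zero]⟩
      exact finite_zpowers.1 (h _ (fg_zpowers x) hz')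
    · intro hx'
      obtain ⟨m, hm, hmx⟩ := isOfFinOrder_iff_pow_eq_one.1 hx'
      have := hz x hx m
      rw [zpow_natCast, hmx, h1] at this
      rcases mul_eq_zero.1 this.symm with h2 | h2
      · exact absurd h2 (by positivity)
      · exact h2
  -- If `ℓ` is zero on `N`, then `N`, hence `G`, is locally finite.
  by_cases hx₀ : ℓ x₀ = 0
  · refine IsLocallyFinite.isLocallyFiniteByDihedral (IsLocallyFinite.of_finiteIndex N ?_)
    intro K hK
    have := h _ (fg_map hK N.subtype) (by
      rintro _ ⟨x, _, rfl⟩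
      obtain ⟨m, hm⟩ := hdvd x
      exact ⟨x.2, by rw [Subgroup.coe_subtype, hm, hx₀, mul_zero]⟩)
    exact Finite.of_equiv _ (K.equivMapOfInjective N.subtype N.subtype_injective).symm.toEquiv
  have hconj : ∀ (g : G) (x : N), g * x * g⁻¹ ∈ N := fun g x => Subgroup.Normal.conj_mem ‹_› _ x.2 g
  choose χ hχ using fun g => hdvd ⟨g * x₀ * g⁻¹, hconj g x₀⟩
  have hratio : ∀ (g : G) (x : N), ℓ (g * x * g⁻¹) = χ g * ℓ x := by
    intro g x
    let l' : N →* Multiplicative ℤ := l.comp (MulAut.conjNormal g).toMonoidHom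
    have hl' : ∀ x : N, (l' x).toAdd = ℓ (g * x * g⁻¹) := fun x => by
      simp [l', hl]
    have h1 : IsOfFinOrder ((x ^ ℓ x₀ * x₀ ^ (-ℓ x) : N) : G) := by
      rw [← hfin _ (Subtype.mem _), ← hl]
      simp [hl]; ring
    have h2 : IsOfFinOrder ((MulAut.conjNormal g (x ^ ℓ x₀ * x₀ ^ (-ℓ x) : N) : N) : G) := by
      rw [MulAut.conjNormal_apply]
      exact (MulAut.conj g).toMonoidHom.isOfFinOrder h1
    rw [← hfin _ (Subtype.mem _), ← hl] at h2
    have h3 : (l' (x ^ ℓ x₀ * x₀ ^ (-ℓ x) : N)).toAdd = 0 := h2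
    rw [map_mul, map_zpow, map_zpow, toAdd_mul, toAdd_zpow, toAdd_zpow, hl', hl'] at h3
    have h4 := hχ g
    simp only at h4
    rw [h4] at h3
    refine mul_left_cancel₀ hx₀ ?_
    simp only [smul_eq_mul] at h3
    linear_combination h3
  have hχmul : ∀ g h, χ (g * h) = χ g * χ h := fun g h => by
    refine mul_right_cancel₀ hx₀ ?_
    have h2 := hratio g ⟨h * x₀ * h⁻¹, hconj h x₀⟩
    rw [hratio h x₀] at h2
    rw [mul_assoc (χ g), ← h2, ← hratio (g * h) x₀]
    congr 1
    simp only [mul_inv_rev, mul_assoc]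
  have hχN : ∀ x ∈ N, χ x = 1 := fun x hx => by
    refine mul_right_cancel₀ hx₀ ?_
    have h2 := hℓ x hx x⁻¹ (N.inv_mem hx)
    rw [mul_inv_cancel, h1] at h2
    rw [← hratio, hℓ _ (N.mul_mem hx x₀.2) _ (N.inv_mem hx), hℓ _ hx _ x₀.2]
    linarith
  have hχ1 : χ 1 = 1 := hχN 1 N.one_mem
  have hχinv : ∀ g, χ g * χ g⁻¹ = 1 := fun g => by rw [← hχmul, mul_inv_cancel, hχ1]
  let X : G →* ℤˣ := MonoidHom.toHomUnits
    { toFun := χ, map_one' := hχ1, map_mul' := hχmul }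
  have hX : ∀ g, (X g : ℤ) = χ g := fun g => rfl
  have : Fintype (G ⧸ N) := Fintype.ofFinite _
  let s : G ⧸ N → G := Quotient.out
  have hs : ∀ (g : G) (q : G ⧸ N), (s (g • q))⁻¹ * (g * s q) ∈ N := fun g q => by
    rw [← QuotientGroup.eq]
    have h3 : ∀ q, (s q : G ⧸ N) = q := fun q => QuotientGroup.out_eq' q
    rw [h3]
    conv_lhs => rw [← h3 q]
    rfl
  -- Each summand compares `g` with the coset representatives `s`; the sign makes the sum a twisted
  -- cocycle.
  let c : G → ℤ := fun g => ∑ q, χ (s (g • q)) * ℓ ((s (g • q))⁻¹ * (g * s q))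
  refine ⟨X, c, fun g h => ?_, fun K hK hK' => finite_of_finite_inf N ?_⟩
  · have e1 : c g = ∑ q, χ (s (g • h • q)) * ℓ ((s (g • h • q))⁻¹ * (g * s (h • q))) :=
      (Fintype.sum_equiv (MulAction.toPerm h) _ _ fun q => rfl).symm
    rw [e1, hX, Finset.mul_sum, ← Finset.sum_add_distrib]
    refine Finset.sum_congr rfl fun q _ => ?_
    have e2 : χ g * χ (s (h • q)) = χ (s (g • h • q)) := by
      rw [← hχmul]
      have := hχmul (s (g • h • q)) ((s (g • h • q))⁻¹ * (g * s (h • q)))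
      rwa [mul_inv_cancel_left, hχN _ (hs g (h • q)), mul_one] at this
    rw [← mul_assoc (χ g), e2, ← mul_add, ← hℓ _ (hs g _) _ (hs h _), mul_smul]
    congr 2
    group
  · refine h _ (fg_inf_of_finiteIndex hK N) fun x hx => ⟨hx.2, ?_⟩
    have h4 : c x = Fintype.card (G ⧸ N) * ℓ x := by
      have h5 : ∀ q : G ⧸ N, x • q = q := fun q => by
        induction q using QuotientGroup.induction_on with
        | H g =>
          refine QuotientGroup.eq.2 ?_
          have := hconj g⁻¹ ⟨x⁻¹, N.inv_mem hx.2⟩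
          simpa [mul_assoc] using this
      simp only [c, h5]
      rw [Finset.sum_congr rfl (g := fun _ => ℓ x), Finset.sum_const, Finset.card_univ,
        nsmul_eq_mul]
      intro q _
      have := hratio (s q)⁻¹ ⟨x, hx.2⟩
      rw [inv_inv, mul_assoc] at this
      rw [this, ← mul_assoc, hχinv, one_mul]
    rw [(hK' x hx.1).2] at h4
    rcases mul_eq_zero.1 h4.symm with h5 | h5
    · exact absurd h5 (by exact_mod_cast Fintype.card_ne_zero)
    · exact h5

/-- On the kernel of `χ` the cocycle is additive; the normal core of that kernel in `G` still has
finite index. The value 0 of `ℓ` outside `N` is never used. -/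
theorem IsLocallyFiniteByDihedral.of_finiteIndex (N : Subgroup G) [N.FiniteIndex]
    (hN : IsLocallyFiniteByDihedral N) : IsLocallyFiniteByDihedral G := by
  obtain ⟨χ, c, hc, h⟩ := hN
  let N₁ : Subgroup G := χ.ker.map N.subtype
  have h1 : N₁.FiniteIndex := by
    have : χ.ker.FiniteIndex := inferInstance
    refine ⟨?_⟩
    rw [Subgroup.index_map_subtype]
    exact mul_ne_zero this.index_ne_zero Subgroup.FiniteIndex.index_ne_zero
  classical
  let ℓ : G → ℤ := fun g => if hg : g ∈ N then c ⟨g, hg⟩ else 0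
  have hℓ : ∀ x : N, ℓ x = c x := fun x => dif_pos x.2
  have hle : N₁.normalCore ≤ N₁ := Subgroup.normalCore_le _
  refine IsLocallyFiniteByDihedral.of_normal_finiteIndex N₁.normalCore ℓ ?_ ?_
  · intro x hx y hy
    obtain ⟨x, hx', rfl⟩ := hle hx
    obtain ⟨y, hy', rfl⟩ := hle hy
    rw [Subgroup.coe_subtype, ← Subgroup.coe_mul, hℓ, hℓ, hℓ, hc, MonoidHom.mem_ker.1 hx']
    simp
  · intro K hK hK'
    have hKN : K ≤ N := fun x hx => by
      obtain ⟨x, _, rfl⟩ := hle (hK' x hx).1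
      exact x.2
    have := h (K.subgroupOf N) ?_ ?_
    · exact Finite.of_equiv _ (Subgroup.subgroupOfEquivOfLe hKN).toEquiv
    · have := (Group.fg_iff_subgroup_fg _).2 hK
      exact (Group.fg_iff_subgroup_fg _).1
        (Group.fg_of_surjective (f := (Subgroup.subgroupOfEquivOfLe hKN).symm.toMonoidHom)
          (MulEquiv.surjective _))
    · intro g hg
      obtain ⟨h2, h3⟩ := hK' g hg
      obtain ⟨g', hg', hgg⟩ := hle h2
      rw [Subgroup.coe_subtype, Subtype.coe_inj] at hgg
      subst hgg
      exact ⟨hg', by rw [← hℓ]; exact h3⟩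

end LocallyFinite
end GroupDim

namespace GroupDim

/-! ### Gluing local homomorphisms to a rational one -/

section RationalHom

variable {S : Type*} [Group S]

/-- A group all of whose finite subsets lie in a subgroup with an integer valued homomorphism that
vanishes on torsion elements only has itself such a homomorphism, with rational values. -/
theorem exists_rational_hom
    (hS : ∀ F : Finset S, ∃ (K : Subgroup S) (r : S → ℤ), (∀ x ∈ F, x ∈ K) ∧
      (∀ x ∈ K, ∀ y ∈ K, r (x * y) = r x + r y) ∧ ∀ x ∈ K, r x = 0 → IsOfFinOrder x)
    (b : S) (hb : ¬ IsOfFinOrder b) :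
    ∃ ℓ : S → ℚ, (∀ x y, ℓ (x * y) = ℓ x + ℓ y) ∧ ℓ b = 1 ∧ ∀ x, ℓ x = 0 ↔ IsOfFinOrder x := by
  have hpow : ∀ (K : Subgroup S) (r : S → ℤ), (∀ x ∈ K, ∀ y ∈ K, r (x * y) = r x + r y) →
      ∀ x ∈ K, ∀ m : ℤ, r (x ^ m) = m * r x := by
    intro K r hr x hx m
    let l : K →* Multiplicative ℤ :=
      MonoidHom.mk' (fun x => Multiplicative.ofAdd (r x)) fun x y => by
      simp [hr x x.2 y y.2]
    have := congrArg Multiplicative.toAdd (map_zpow l ⟨x, hx⟩ m)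
    rwa [toAdd_zpow, smul_eq_mul] at this
  have htors : ∀ (K : Subgroup S) (r : S → ℤ), (∀ x ∈ K, ∀ y ∈ K, r (x * y) = r x + r y) →
      ∀ x ∈ K, IsOfFinOrder x → r x = 0 := by
    intro K r hr x hx hfin
    obtain ⟨m, hm, hmx⟩ := isOfFinOrder_iff_pow_eq_one.1 hfin
    have h1 := hpow K r hr x hx m
    have h2 := hr 1 K.one_mem 1 K.one_mem
    rw [mul_one] at h2
    rw [zpow_natCast, hmx, show r 1 = 0 by linarith] at h1
    rcases mul_eq_zero.1 h1.symm with h | h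
    · exact absurd h (by positivity)
    · exact h
  classical
  choose K r hK hr hr0 using hS
  let ℓ : S → ℚ := fun x => r {b, x} x / r {b, x} b
  -- The ratio does not depend on the local homomorphism: $x^{r(b)}b^{-r(x)}$ is killed by one,
  -- hence is torsion, hence is killed by every other.
  have hcons : ∀ F : Finset S, b ∈ F → ∀ x ∈ F, ℓ x = r F x / r F b := by
    intro F hbF x hxF
    have hx₁ := hK {b, x} x (by simp)
    have hb₁ := hK {b, x} b (by simp)
    have hx₂ := hK F x hxF
    have hb₂ := hK F b hbF
    have hne₁ : r {b, x} b ≠ 0 := fun h => hb (hr0 _ _ hb₁ h)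
    have hne₂ : r F b ≠ 0 := fun h => hb (hr0 _ _ hb₂ h)
    have h1 : r F (x ^ r F b * b ^ (-r F x)) = 0 := by
      rw [hr F _ (zpow_mem hx₂ _) _ (zpow_mem hb₂ _), hpow _ _ (hr F) x hx₂,
        hpow _ _ (hr F) b hb₂]
      ring
    have h2 := htors _ _ (hr {b, x}) _ (mul_mem (zpow_mem hx₁ _) (zpow_mem hb₁ _))
      (hr0 F _ (mul_mem (zpow_mem hx₂ _) (zpow_mem hb₂ _)) h1)
    rw [hr _ _ (zpow_mem hx₁ _) _ (zpow_mem hb₁ _), hpow _ _ (hr _) x hx₁,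
      hpow _ _ (hr _) b hb₁] at h2
    rw [div_eq_div_iff (by exact_mod_cast hne₁) (by exact_mod_cast hne₂)]
    have : r {b, x} x * r F b = r F x * r {b, x} b := by linarith
    exact_mod_cast this
  refine ⟨ℓ, fun x y => ?_, ?_, fun x => ?_⟩
  · rw [hcons {b, x, y, x * y} (by simp) x (by simp), hcons {b, x, y, x * y} (by simp) y (by simp),
      hcons {b, x, y, x * y} (by simp) (x * y) (by simp),
      hr _ x (hK _ _ (by simp)) y (hK _ _ (by simp))]
    push_cast
    ring
  · refine div_self ?_
    have := hK {b, b} b (by simp)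
    exact_mod_cast fun h => hb (hr0 _ _ this h)
  · have hx₁ := hK {b, x} x (by simp)
    have hb₁ := hK {b, x} b (by simp)
    have hne₁ : (r {b, x} b : ℚ) ≠ 0 := by exact_mod_cast fun h => hb (hr0 _ _ hb₁ h)
    rw [div_eq_zero_iff, or_iff_left hne₁, Int.cast_eq_zero]
    exact ⟨hr0 _ _ hx₁, htors _ _ (hr _) _ hx₁⟩

/-- With $\ell(x)=u/v$ the element $x^v b^{-u}$ is torsion, and so is its image under `ψ`; hence
$\ell(\psi x)$ is determined by $\ell(\psi b)$. -/
theorem exists_ratio {ℓ : S → ℚ} (hadd : ∀ x y, ℓ (x * y) = ℓ x + ℓ y) {b : S} (hb : ℓ b = 1)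
    (hfin : ∀ x, ℓ x = 0 ↔ IsOfFinOrder x) (ψ : MulAut S) :
    ∃ μ : ℚ, μ ≠ 0 ∧ ∀ x, ℓ (ψ x) = μ * ℓ x := by
  have hz : ∀ (x : S) (m : ℤ), ℓ (x ^ m) = m * ℓ x := fun x m => by
    let l : S →* Multiplicative ℚ :=
      MonoidHom.mk' (fun x => Multiplicative.ofAdd (ℓ x)) fun x y => by
      simp [hadd]
    have := congrArg Multiplicative.toAdd (map_zpow l x m)
    rwa [toAdd_zpow, zsmul_eq_mul] at this
  have hψ : ∀ x, ℓ (ψ x) = 0 ↔ ℓ x = 0 := fun x => by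
    rw [hfin, hfin]
    exact ⟨fun h => by simpa using (ψ⁻¹ : MulAut S).toMonoidHom.isOfFinOrder h,
      fun h => ψ.toMonoidHom.isOfFinOrder h⟩
  refine ⟨ℓ (ψ b), fun h => ?_, fun x => ?_⟩
  · rw [hψ, hb] at h
    exact one_ne_zero h
  · have h1 : ℓ (x ^ ((ℓ x).den : ℤ) * b ^ (-(ℓ x).num)) = 0 := by
      rw [hadd, hz, hz, hb]
      push_cast
      have := Rat.den_mul_eq_num (ℓ x)
      linarith
    rw [← hψ, map_mul, map_zpow, map_zpow, hadd, hz, hz] at h1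
    have h2 := Rat.den_mul_eq_num (ℓ x)
    have h3 : ((ℓ x).den : ℚ) ≠ 0 := by exact_mod_cast (ℓ x).den_ne_zero
    refine mul_left_cancel₀ h3 ?_
    push_cast at h1
    rw [mul_left_comm, h2]
    linarith

end RationalHom

/-! ### Elements of infinite order modulo a normalized subgroup -/

section Shift

theorem map_zpow_aut_apply {S Q : Type*} [Group S] [Group Q] (f : S →* Q) (d : Q) (φ : MulAut S)
    (h : ∀ x, f (φ x) = d * f x * d⁻¹) (n : ℤ) (x : S) :
    f ((φ ^ n) x) = d ^ n * f x * (d ^ n)⁻¹ := by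
  have key : ∀ (n : ℕ) x, f ((φ ^ n) x) = d ^ n * f x * (d ^ n)⁻¹ := by
    intro n
    induction n with
    | zero => simp
    | succ n ih =>
      intro x
      rw [pow_succ', MulAut.mul_apply, h, ih, pow_succ']
      group
  obtain ⟨n, rfl | rfl⟩ := n.eq_nat_or_neg
  · simpa using key n x
  · have := key n ((φ ^ (-n : ℤ)) x)
    rw [← zpow_natCast, ← MulAut.mul_apply, ← zpow_add, add_neg_cancel, zpow_zero,
      MulAut.one_apply, ← zpow_natCast] at this
    rw [this]
    group

variable {k Γ : Type u} [CommRing k] [Nontrivial k] [Group Γ]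

/-- A group of small homology does not contain a semidirect product by an infinite cyclic group
of a group with a non-trivial rational homomorphism that is torsion on its kernel. -/
theorem not_smallHomology_of_rational_hom (S : Subgroup Γ) {ℓ : S → ℚ}
    (hadd : ∀ x y, ℓ (x * y) = ℓ x + ℓ y) {b : S} (hb : ℓ b = 1)
    (hfin : ∀ x, ℓ x = 0 ↔ IsOfFinOrder x) {a : Γ} (ha : a ∈ Subgroup.normalizer (S : Set Γ))
    (hinf : ∀ n : ℤ, a ^ n ∈ S → n = 0) : ¬ SmallHomology k Γ := by
  intro hΓ
  let ψ : MulAut S := Subgroup.normalizerMonoidHom S ⟨a, ha⟩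
  have hψ : ∀ x : S, ((ψ x : S) : Γ) = a * x * a⁻¹ := fun x => rfl
  obtain ⟨μ, hμ, hμℓ⟩ := exists_ratio hadd hb hfin ψ
  -- Squaring makes the scaling factor positive, so that it acts on the line preserving the order.
  let φ : MulAut S := ψ * ψ
  let t : Γ := a * a
  let lam : ℚ := μ * μ
  have hlam : 0 < lam := mul_self_pos.2 hμ
  have hφ : ∀ x : S, S.subtype (φ x) = t * S.subtype x * t⁻¹ := fun x => by
    change ((ψ (ψ x) : S) : Γ) = _
    rw [hψ, hψ]
    simp only [t, Subgroup.coe_subtype]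
    group
  have hφℓ : ∀ x : S, ℓ (φ x) = lam * ℓ x := fun x => by
    change ℓ (ψ (ψ x)) = _
    rw [hμℓ, hμℓ, mul_assoc]
  let Φ : Multiplicative ℤ →* MulAut S := zpowersHom _ φ
  let j : S ⋊[Φ] Multiplicative ℤ →* Γ :=
    SemidirectProduct.lift S.subtype (zpowersHom Γ t) fun g => by
    ext x
    exact map_zpow_aut_apply S.subtype t φ hφ g.toAdd x
  have hj : Function.Injective j := by
    rw [injective_iff_map_eq_one]
    intro g hg
    have h1 : (g.left : Γ) * t ^ g.right.toAdd = 1 := hg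
    have h2 : t ^ g.right.toAdd = (g.left : Γ)⁻¹ := (inv_eq_of_mul_eq_one_right h1).symm
    have h3 : a ^ (2 * g.right.toAdd) ∈ S := by
      rw [zpow_mul, zpow_ofNat, sq, h2]
      exact S.inv_mem g.left.2
    have h4 : g.right.toAdd = 0 := by have := hinf _ h3; omega
    rw [h4, zpow_zero, mul_one] at h1
    exact SemidirectProduct.ext (Subtype.ext h1) h4
  let T : S →* (ℚ ≃o ℚ) :=
    { toFun := fun x => OrderIso.addRight (ℓ x)
      map_one' := by
        have : ℓ 1 = 0 := by simpa using hadd 1 1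
        ext x
        simp [this]
      map_mul' := fun x y => by
        ext z
        simp only [OrderIso.addRight_apply, RelIso.mul_apply, hadd]
        ring }
  have hT : ∀ x z, T x z = z + ℓ x := fun x z => rfl
  let D : ℚ ≃o ℚ := OrderIso.mulLeft₀ lam hlam
  have hD : ∀ z, D z = lam * z := fun z => rfl
  let α : S ⋊[Φ] Multiplicative ℤ →* (ℚ ≃o ℚ) :=
    SemidirectProduct.lift T (zpowersHom _ D) fun g => by
    ext1 x
    refine map_zpow_aut_apply T D φ (fun x => ?_) g.toAdd x
    rw [eq_mul_inv_iff_mul_eq]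
    ext z
    rw [RelIso.mul_apply, RelIso.mul_apply, hT, hD, hD, hT, hφℓ]
    ring
  let e : S ⋊[Φ] Multiplicative ℤ ≃* j.range := MonoidHom.ofInjective hj
  let β : S ⋊[Φ] Multiplicative ℤ := SemidirectProduct.inl b
  let τ₀ : S ⋊[Φ] Multiplicative ℤ := SemidirectProduct.inr (Multiplicative.ofAdd 1)
  have hαβ : α β = T b := SemidirectProduct.lift_inl _ _ _ _
  have hατ : α τ₀ = D := (SemidirectProduct.lift_inr _ _ _ _).trans (zpow_one D)
  let p : ℕ := lam.num.toNat
  let q : ℕ := lam.den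
  have hp : 0 < p := by
    have := Rat.num_pos.2 hlam
    omega
  have hpq : (p / q : ℚ) = lam := by
    have h1 : ((lam.num.toNat : ℕ) : ℤ) = lam.num := Int.toNat_of_nonneg (Rat.num_nonneg.2 hlam.le)
    have h2 : ((lam.num.toNat : ℕ) : ℚ) = (lam.num : ℚ) := by exact_mod_cast h1
    rw [h2]
    exact Rat.num_div_den lam
  have hz : ∀ (x : S) (m : ℕ), ℓ (x ^ m) = m * ℓ x := fun x m => by
    induction m with
    | zero => simpa using hadd 1 1
    | succ m ih => rw [pow_succ, hadd, ih]; push_cast; ring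
  -- With scaling factor $p/q$, `ℓ` takes the same value on $b^p$ and $\varphi(b)^q$, so their
  -- quotient is torsion; it serves as the `τ` of the affine relation.
  let σ : S := (b ^ p)⁻¹ * (φ b) ^ q
  have hσ : IsOfFinOrder σ := by
    have h1 : b ^ p * σ = (φ b) ^ q := mul_inv_cancel_left _ _
    have h2 := congrArg ℓ h1
    rw [hadd, hz, hz, hφℓ, hb, ← hpq] at h2
    have hq0 : (q : ℚ) ≠ 0 := by exact_mod_cast lam.den_ne_zero
    rw [← hfin]
    field_simp at h2
    linarith
  have hconj : τ₀ * β * τ₀⁻¹ = SemidirectProduct.inl (φ b) := by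
    have := SemidirectProduct.inl_aut (φ := Φ) (Multiplicative.ofAdd 1) b
    simp only [Φ, zpowersHom_apply, toAdd_ofAdd, zpow_one] at this
    rw [map_inv] at this
    exact this.symm
  let s : S ⋊[Φ] Multiplicative ℤ := SemidirectProduct.inl σ
  have hs : IsOfFinOrder (e s) := by
    have : IsOfFinOrder s := SemidirectProduct.inl.isOfFinOrder hσ
    exact e.toMonoidHom.isOfFinOrder this
  have hrel : (τ₀ * β * τ₀⁻¹) ^ q = β ^ p * s := by
    rw [hconj, ← map_pow, ← mul_inv_cancel_left (b ^ p) (φ b ^ q), map_mul, map_pow]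
  refine not_smallHomology_of_affine (k := k) (G := j.range) (α.comp e.symm.toMonoidHom)
    (θ := SemidirectProduct.rightHom.comp e.symm.toMonoidHom) (b := e β) (t := e τ₀) (τ := e s)
    (p := p) (q := q) (r := orderOf (e s)) hp lam.den_pos ?_ ?_ ?_ (pow_orderOf_eq_one _)
    ((hΓ.subgroup j.range).isUnit_orderOf hs) (fun x => ?_) (fun x => ?_) (hΓ.subgroup j.range)
  · simp [β]
  · simp [τ₀]
  · rw [← map_inv, ← map_mul, ← map_mul, ← map_pow, ← map_pow, ← map_mul, hrel]
  · rw [MonoidHom.comp_apply, MulEquiv.coe_toMonoidHom, MulEquiv.symm_apply_apply, hαβ, hT, hb]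
  · rw [MonoidHom.comp_apply, MulEquiv.coe_toMonoidHom, MulEquiv.symm_apply_apply, hατ, hD, hpq]

theorem isOfFinOrder_coe_subgroup {G : Type*} [Group G] {H : Subgroup G} {x : H} :
    IsOfFinOrder (x : G) ↔ IsOfFinOrder x :=
  Submonoid.isOfFinOrder_coe (H := H.toSubmonoid)

/-- On the kernel of `χ`, of finite index, `c` is a homomorphism to $\mathbb Z$ and so vanishes on
torsion. -/
theorem IsLocallyFiniteByDihedral.isLocallyFinite {G : Type*} [Group G]
    (hG : IsLocallyFiniteByDihedral G) (h : ∀ x : G, IsOfFinOrder x) : IsLocallyFinite G := by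
  obtain ⟨χ, c, hc, hK⟩ := hG
  have : χ.ker.FiniteIndex := inferInstance
  refine IsLocallyFinite.of_finiteIndex χ.ker fun K hK' => ?_
  have hχ : ∀ x ∈ K.map χ.ker.subtype, χ x = 1 := by
    rintro _ ⟨x, _, rfl⟩
    exact x.2
  have := hK _ (fg_map hK' χ.ker.subtype) fun x hx => ⟨hχ x hx, ?_⟩
  · exact Finite.of_equiv _ (K.equivMapOfInjective _ χ.ker.subtype_injective).symm.toEquiv
  · have hx1 := hχ x hx
    have h1 : c 1 = 0 := by simpa using hc 1 1
    have hpow : ∀ n : ℕ, c (x ^ n) = n * c x := fun n => by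
      induction n with
      | zero => simp [h1]
      | succ n ih => rw [pow_succ, hc, ih, map_pow, hx1]; push_cast; ring
    obtain ⟨n, hn, hxn⟩ := isOfFinOrder_iff_pow_eq_one.1 (h x)
    have := hpow n
    rw [hxn, h1] at this
    rcases mul_eq_zero.1 this.symm with h | h
    · exact absurd h (by positivity)
    · exact h

/-- The subgroup generated by the squares of the elements of a subgroup. -/
def squares (K : Subgroup Γ) : Subgroup Γ := Subgroup.closure ((fun x => x * x) '' K)

theorem squares_mono {K K' : Subgroup Γ} (h : K ≤ K') : squares K ≤ squares K' :=
  Subgroup.closure_mono (Set.image_mono h)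

theorem squares_le (K : Subgroup Γ) : squares K ≤ K :=
  (Subgroup.closure_le K).2 (by rintro _ ⟨x, hx, rfl⟩; exact K.mul_mem hx hx)

theorem exists_fg_mem_squares {K : Subgroup Γ} {x : Γ} (hx : x ∈ squares K) :
    ∃ H ≤ K, H.FG ∧ x ∈ squares H := by
  induction hx using Subgroup.closure_induction with
  | mem x hx =>
    obtain ⟨y, hy, rfl⟩ := hx
    exact ⟨Subgroup.zpowers y, by simpa using hy, fg_zpowers y,
      Subgroup.subset_closure ⟨y, Subgroup.mem_zpowers y, rfl⟩⟩
  | one => exact ⟨⊥, bot_le, Subgroup.FG.bot, one_mem _⟩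
  | mul x y _ _ hx hy =>
    obtain ⟨H, hH, hHfg, hxH⟩ := hx
    obtain ⟨H', hH', hHfg', hyH⟩ := hy
    exact ⟨H ⊔ H', sup_le hH hH', hHfg.sup hHfg',
      mul_mem (squares_mono le_sup_left hxH) (squares_mono le_sup_right hyH)⟩
  | inv x _ hx =>
    obtain ⟨H, hH, hHfg, hxH⟩ := hx
    exact ⟨H, hH, hHfg, inv_mem hxH⟩

theorem exists_fg_subset_squares {K : Subgroup Γ} (F : Finset (squares K)) :
    ∃ H ≤ K, H.FG ∧ ∀ x ∈ F, (x : Γ) ∈ squares H := by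
  classical
  induction F using Finset.induction_on with
  | empty => exact ⟨⊥, bot_le, Subgroup.FG.bot, by simp⟩
  | insert x F _ ih =>
    obtain ⟨H, hH, hHfg, hF⟩ := ih
    obtain ⟨H', hH', hHfg', hx⟩ := exists_fg_mem_squares x.2
    refine ⟨H ⊔ H', sup_le hH hH', hHfg.sup hHfg', fun y hy => ?_⟩
    rcases Finset.mem_insert.1 hy with rfl | hy
    · exact squares_mono le_sup_right hx
    · exact squares_mono le_sup_left (hF y hy)

/-- In a group of small homology, a subgroup that is locally (locally finite)-by-dihedral and is
normalized by an element of infinite order modulo it is locally finite. -/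
theorem isLocallyFinite_of_shift (hΓ : SmallHomology k Γ) {K : Subgroup Γ}
    (hK : ∀ H ≤ K, H.FG → IsLocallyFiniteByDihedral H) {a : Γ}
    (ha : a ∈ Subgroup.normalizer (K : Set Γ)) (hinf : ∀ n : ℤ, a ^ n ∈ K → n = 0) :
    IsLocallyFinite K := by
  by_contra hlf
  have hb : ∃ b ∈ K, ¬ IsOfFinOrder b := by
    by_contra hall
    push Not at hall
    refine hlf fun H hH => ?_
    have hH' := hK (H.map K.subtype) (Subgroup.map_subtype_le H) (fg_map hH _)
    have h1 := hH'.isLocallyFinite fun x => by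
      rw [← isOfFinOrder_coe_subgroup]
      exact hall _ (Subgroup.map_subtype_le H x.2)
    have : Group.FG (H.map K.subtype) := (Group.fg_iff_subgroup_fg _).2 (fg_map hH _)
    have := h1.finite
    exact Finite.of_equiv _ (H.equivMapOfInjective _ K.subtype_injective).symm.toEquiv
  obtain ⟨b₀, hb₀, hb₀'⟩ := hb
  -- Squares have trivial sign, so on `squares K` each local cocycle is additive. This subgroup is
  -- still normalized by `a` and still contains an element of infinite order.
  let b : squares K := ⟨b₀ * b₀, Subgroup.subset_closure ⟨b₀, hb₀, rfl⟩⟩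
  have hbinf : ¬ IsOfFinOrder b := by
    rw [← isOfFinOrder_coe_subgroup]
    intro h
    rw [isOfFinOrder_iff_pow_eq_one] at h
    obtain ⟨n, hn, h⟩ := h
    refine hb₀' (isOfFinOrder_iff_pow_eq_one.2 ⟨2 * n, by omega, ?_⟩)
    rw [pow_mul, sq]
    exact h
  have hS : ∀ F : Finset (squares K), ∃ (K' : Subgroup (squares K)) (r : squares K → ℤ),
      (∀ x ∈ F, x ∈ K') ∧ (∀ x ∈ K', ∀ y ∈ K', r (x * y) = r x + r y) ∧
      ∀ x ∈ K', r x = 0 → IsOfFinOrder x := fun F => by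
    obtain ⟨H, hHK, hHfg, hF⟩ := exists_fg_subset_squares F
    obtain ⟨χ, c, hc, hχc⟩ := hK H hHK hHfg
    classical
    let r : Γ → ℤ := fun x => if hx : x ∈ H then c ⟨x, hx⟩ else 0
    have hr : ∀ x : H, r x = c x := fun x => dif_pos x.2
    have hχ : ∀ x ∈ squares H, ∀ hx : x ∈ H, χ ⟨x, hx⟩ = 1 := by
      intro x hx
      induction hx using Subgroup.closure_induction with
      | mem x hx =>
        obtain ⟨y, hy, rfl⟩ := hx
        intro hx
        have : (⟨y * y, hx⟩ : H) = ⟨y, hy⟩ * ⟨y, hy⟩ := rfl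
        simp only [this, map_mul, Int.units_mul_self]
      | one => intro _; exact map_one χ
      | mul x y hx hy ihx ihy =>
        intro _
        have h1 := ihx (squares_le H hx)
        have h2 := ihy (squares_le H hy)
        have : (⟨x * y, by assumption⟩ : H) = ⟨x, squares_le H hx⟩ * ⟨y, squares_le H hy⟩ := rfl
        rw [this, map_mul, h1, h2, one_mul]
      | inv x hx ihx =>
        intro _
        have h1 := ihx (squares_le H hx)
        have : (⟨x⁻¹, by assumption⟩ : H) = ⟨x, squares_le H hx⟩⁻¹ := rfl
        rw [this, map_inv, h1, inv_one]
    have hradd : ∀ x ∈ squares H, ∀ y ∈ squares H, r (x * y) = r x + r y := by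
      intro x hx y hy
      have h1 := hr (⟨x, squares_le H hx⟩ * ⟨y, squares_le H hy⟩)
      rw [hc, hχ x hx, Units.val_one, one_mul, ← hr, ← hr] at h1
      exact h1
    refine ⟨(squares H).subgroupOf (squares K), fun x => r x, hF, fun x hx y hy =>
      hradd x hx y hy, fun x hx h0 => ?_⟩
    rw [← isOfFinOrder_coe_subgroup]
    let x' : H := ⟨x, squares_le H hx⟩
    have hx' : IsOfFinOrder x' := by
      refine finite_zpowers.1 (hχc _ (fg_zpowers x') ?_)
      have key : ∀ n : ℤ, c (x' ^ n) = n * c x' := by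
        have hχx : χ x' = 1 := hχ x hx _
        let l : Subgroup.zpowers x' →* Multiplicative ℤ :=
          MonoidHom.mk' (fun y => Multiplicative.ofAdd (c y)) fun y z => by
            obtain ⟨n, hn⟩ := y.2
            have : χ y = 1 := by rw [← hn, map_zpow, hχx, one_zpow]
            rw [Subgroup.coe_mul, hc, this]
            simp
        intro n
        have := congrArg Multiplicative.toAdd (map_zpow l ⟨x', Subgroup.mem_zpowers x'⟩ n)
        rwa [toAdd_zpow, smul_eq_mul] at this
      rintro _ ⟨n, rfl⟩
      refine ⟨?_, ?_⟩
      · simp only [map_zpow]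
        rw [hχ x hx, one_zpow]
      · simp only [key]
        rw [← hr]
        exact mul_eq_zero_of_right _ h0
    exact (isOfFinOrder_coe_subgroup (x := x')).2 hx'
  obtain ⟨ℓ, hadd, hb1, hfin⟩ := exists_rational_hom hS b hbinf
  refine not_smallHomology_of_rational_hom (k := k) (squares K) hadd hb1 hfin (a := a) ?_
    (fun n hn => hinf n (squares_le K hn)) hΓ
  refine Subgroup.normalizer_le_normalizer_closure _ ?_
  intro x
  rw [Subgroup.mem_normalizer_iff] at ha
  constructor
  · rintro ⟨y, hy, rfl⟩
    exact ⟨a * y * a⁻¹, (ha y).1 hy, by group⟩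
  · rintro ⟨y, hy, hyx⟩
    refine ⟨a⁻¹ * y * a, (ha _).2 (by simpa [mul_assoc] using hy), ?_⟩
    have : x = a⁻¹ * (a * x * a⁻¹) * a := by group
    rw [this, ← hyx]
    group

end Shift
end GroupDim

namespace GroupDim

/-! ### Induction over the elementary amenable class -/

section Structure

variable {Γ : Type u} [Group Γ]

/-- All finitely generated subgroups of `K` are (locally finite)-by-dihedral. -/
def LocallyDihedral (K : Subgroup Γ) : Prop :=
  ∀ H ≤ K, H.FG → IsLocallyFiniteByDihedral H

theorem LocallyDihedral.mono {K K' : Subgroup Γ} (hK : LocallyDihedral K) (h : K' ≤ K) :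
    LocallyDihedral K' := fun H hH => hK H (hH.trans h)

theorem LocallyDihedral.of_finiteIndex {K₀ K : Subgroup Γ} (hK₀ : LocallyDihedral K₀)
    [hfin : (K₀.subgroupOf K).FiniteIndex] : LocallyDihedral K := by
  intro H hH hHfg
  have : Group.FG H := (Group.fg_iff_subgroup_fg _).2 hHfg
  have h1 : (K₀.subgroupOf H).FiniteIndex := by
    have : K₀.subgroupOf H = (K₀.subgroupOf K).comap (Subgroup.inclusion hH) := rfl
    refine ⟨?_⟩
    rw [this, Subgroup.index_comap]
    exact Subgroup.FiniteIndex.index_ne_zero (H := (K₀.subgroupOf K).subgroupOf _)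
  refine IsLocallyFiniteByDihedral.of_finiteIndex (K₀.subgroupOf H) ?_
  have h2 := (Group.fg_iff_subgroup_fg _).1 (Subgroup.fg_of_index_ne_zero (K₀.subgroupOf H))
  have h3 := hK₀ ((K₀.subgroupOf H).map H.subtype)
    (by rw [Subgroup.subgroupOf_map_subtype]; exact inf_le_left) (fg_map h2 _)
  exact h3.of_injective
    (f := ((K₀.subgroupOf H).equivMapOfInjective _ H.subtype_injective).toMonoidHom)
    (MulEquiv.injective _)

/-- The subgroup generated by a subgroup and an element that normalizes it. -/
def extendBy (K : Subgroup Γ) {a : Γ} (ha : a ∈ Subgroup.normalizer (K : Set Γ)) : Subgroup Γ where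
  carrier := {x | ∃ n : ℤ, x * a ^ (-n) ∈ K}
  one_mem' := ⟨0, by simp⟩
  mul_mem' := by
    rintro x y ⟨n, hn⟩ ⟨m, hm⟩
    refine ⟨n + m, ?_⟩
    have h1 := (Subgroup.mem_normalizer_iff.1 (zpow_mem ha n) _).1 hm
    have h2 := mul_mem hn h1
    convert h2 using 1
    group
  inv_mem' := by
    rintro x ⟨n, hn⟩
    refine ⟨-n, ?_⟩
    have h1 := (Subgroup.mem_normalizer_iff.1 (zpow_mem ha (-n)) _).1 (inv_mem hn)
    convert h1 using 1
    group

theorem le_extendBy {K : Subgroup Γ} {a : Γ} (ha : a ∈ Subgroup.normalizer (K : Set Γ)) :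
    K ≤ extendBy K ha := fun x hx => ⟨0, by simpa using hx⟩

theorem self_mem_extendBy {K : Subgroup Γ} {a : Γ} (ha : a ∈ Subgroup.normalizer (K : Set Γ)) :
    a ∈ extendBy K ha := ⟨1, by simp⟩

/-- If no non-zero power of `a` lies in `K`, then `K` is locally finite and the exponent of `a` is a
homomorphism to $\mathbb Z$ with kernel `K`. Otherwise `K` has finite index. -/
theorem LocallyDihedral.extendBy {k : Type u} [CommRing k] [Nontrivial k] (hΓ : SmallHomology k Γ)
    {K : Subgroup Γ} (hK : LocallyDihedral K) {a : Γ}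
    (ha : a ∈ Subgroup.normalizer (K : Set Γ)) : LocallyDihedral (extendBy K ha) := by
  by_cases hinf : ∀ n : ℤ, a ^ n ∈ K → n = 0
  · have hlf := isLocallyFinite_of_shift hΓ hK ha hinf
    suffices h : IsLocallyFiniteByDihedral (GroupDim.extendBy K ha) from fun H hH _ =>
      h.of_injective (f := Subgroup.inclusion hH) (Subgroup.inclusion_injective hH)
    choose c hc using fun x : GroupDim.extendBy K ha => x.2
    have huniq : ∀ (x : Γ) (n m : ℤ), x * a ^ (-n) ∈ K → x * a ^ (-m) ∈ K → n = m := by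
      intro x n m hn hm
      have := hinf (m - n) (by
        have := mul_mem (inv_mem hm) hn
        convert this using 1
        group)
      omega
    refine ⟨1, c, fun x y => ?_, fun H hH h0 => ?_⟩
    · rw [MonoidHom.one_apply, Units.val_one, one_mul]
      refine huniq (x * y : Γ) _ _ (hc (x * y)) ?_
      have h1 := (Subgroup.mem_normalizer_iff.1 (zpow_mem ha (c x)) _).1 (hc y)
      have h2 := mul_mem (hc x) h1
      convert h2 using 1
      group
    · have hle : H.map (GroupDim.extendBy K ha).subtype ≤ K := by
        rintro _ ⟨x, hx, rfl⟩
        have := hc x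
        rw [(h0 x hx).2] at this
        simpa using this
      have h1 := hlf ((H.map (GroupDim.extendBy K ha).subtype).subgroupOf K) (by
        have := (Group.fg_iff_subgroup_fg _).2 (fg_map hH (GroupDim.extendBy K ha).subtype)
        exact (Group.fg_iff_subgroup_fg _).1
          (Group.fg_of_surjective (f := (Subgroup.subgroupOfEquivOfLe hle).symm.toMonoidHom)
            (MulEquiv.surjective _)))
      have h2 := Finite.of_equiv _ (Subgroup.subgroupOfEquivOfLe hle).toEquiv
      exact Finite.of_equiv _ (H.equivMapOfInjective _ (Subgroup.subtype_injective _)).symm.toEquiv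
  · push Not at hinf
    obtain ⟨n, hn, hn0⟩ := hinf
    have : Finite (GroupDim.extendBy K ha ⧸ K.subgroupOf (GroupDim.extendBy K ha)) := by
      let a' : GroupDim.extendBy K ha := ⟨a, self_mem_extendBy ha⟩
      refine Finite.of_surjective (fun i : Set.Ico 0 |n| => QuotientGroup.mk (a' ^ (i : ℤ))) ?_
      intro q
      induction q using QuotientGroup.induction_on with
      | H x =>
        obtain ⟨m, hm⟩ := x.2
        refine ⟨⟨m % n, Int.emod_nonneg _ hn0, Int.emod_lt_abs _ hn0⟩, ?_⟩
        refine QuotientGroup.eq.2 ?_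
        rw [Subgroup.mem_subgroupOf]
        have h1 := (Subgroup.mem_normalizer_iff.1 (zpow_mem ha (-(m % n))) _).1 hm
        have h2 := mul_mem h1 (zpow_mem hn (m / n))
        convert h2 using 1
        have h3 : m = m % n + n * (m / n) := (Int.emod_add_mul_ediv m n).symm
        change (a ^ (m % n))⁻¹ * (x : Γ) = _
        rw [← zpow_mul]
        have h4 : a ^ (-m) = a ^ (-(n * (m / n))) * a ^ (-(m % n)) := by
          rw [← zpow_add]; congr 1; omega
        rw [h4]
        group
    have : (K.subgroupOf (GroupDim.extendBy K ha)).FiniteIndex :=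
      Subgroup.finiteIndex_of_finite_quotient
    exact hK.of_finiteIndex

variable (Γ) in
/-- Subgroups of `Γ` inherit local dihedrality from kernels of homomorphisms to `Q`. -/
def LiftsDihedral (Q : Type u) [Group Q] : Prop :=
  ∀ (K : Subgroup Γ) (f : K →* Q), LocallyDihedral (f.ker.map K.subtype) → LocallyDihedral K

theorem liftsDihedral_of_finite (Q : Type u) [Group Q] [Finite Q] : LiftsDihedral Γ Q := by
  intro K f hK
  have : ((f.ker.map K.subtype).subgroupOf K).FiniteIndex := by
    have h : (f.ker.map K.subtype).subgroupOf K = f.ker :=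
      Subgroup.comap_map_eq_self_of_injective K.subtype_injective _
    rw [h]
    infer_instance
  exact hK.of_finiteIndex

/-- Commutators of `K` lie in the kernel of `f`, so each subgroup between that kernel and `K` is
normalized by `K`, and generators can be adjoined one at a time. -/
theorem liftsDihedral_of_comm {k : Type u} [CommRing k] [Nontrivial k] (hΓ : SmallHomology k Γ)
    (Q : Type u) [Group Q] (hQ : ∀ a b : Q, a * b = b * a) : LiftsDihedral Γ Q := by
  intro K f hK
  set K₀ := f.ker.map K.subtype with hK₀
  have hcomm : ∀ x ∈ K, ∀ y ∈ K, x * y * x⁻¹ * y⁻¹ ∈ K₀ := by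
    intro x hx y hy
    refine ⟨⟨x, hx⟩ * ⟨y, hy⟩ * ⟨x, hx⟩⁻¹ * ⟨y, hy⟩⁻¹, ?_, rfl⟩
    simp only [SetLike.mem_coe, MonoidHom.mem_ker, map_mul, map_inv]
    rw [hQ (f ⟨x, hx⟩)]
    group
  have hle : K₀ ≤ K := Subgroup.map_subtype_le _
  have key : ∀ F : Finset Γ, (∀ x ∈ F, x ∈ K) →
      LocallyDihedral (K₀ ⊔ Subgroup.closure (F : Set Γ)) := by
    classical
    intro F
    induction F using Finset.induction_on with
    | empty => intro _; simpa using hK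
    | insert a F _ ih =>
      intro hF
      have hM := ih fun x hx => hF x (Finset.mem_insert_of_mem hx)
      have haK : a ∈ K := hF a (Finset.mem_insert_self _ _)
      set M := K₀ ⊔ Subgroup.closure (F : Set Γ) with hMdef
      have hMK : M ≤ K := sup_le hle ((Subgroup.closure_le K).2 fun x hx =>
        hF x (Finset.mem_insert_of_mem hx))
      have hconj : ∀ g ∈ K, ∀ x ∈ M, g * x * g⁻¹ ∈ M := fun g hg x hx => by
        have := mul_mem (le_sup_left (a := K₀) (hcomm g hg x (hMK hx))) hx
        simpa using this
      have ha : a ∈ Subgroup.normalizer (M : Set Γ) := by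
        rw [Subgroup.mem_normalizer_iff]
        refine fun x => ⟨hconj a haK x, fun hx => ?_⟩
        have := hconj a⁻¹ (inv_mem haK) _ hx
        convert this using 1
        group
      refine (hM.extendBy hΓ ha).mono (sup_le (le_sup_left.trans (le_extendBy ha)) ?_)
      rw [Subgroup.closure_le]
      intro x hx
      rcases Finset.mem_insert.1 hx with rfl | hx
      · exact self_mem_extendBy ha
      · exact le_extendBy ha (le_sup_right (a := K₀) (Subgroup.subset_closure hx))
  intro H hH hHfg
  obtain ⟨F, rfl⟩ := hHfg
  exact key F (fun x hx => hH (Subgroup.subset_closure hx)) _ le_sup_right ⟨F, rfl⟩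

/-- Climb from the kernel of `f` to the preimage of `N`, then from there to `K`. -/
theorem LiftsDihedral.extension {Q : Type u} [Group Q] (N : Subgroup Q) [N.Normal]
    (hN : LiftsDihedral Γ N) (hQ : LiftsDihedral Γ (Q ⧸ N)) : LiftsDihedral Γ Q := by
  intro K f hK
  let K₁ : Subgroup Γ := (N.comap f).map K.subtype
  let e : N.comap f ≃* K₁ := (N.comap f).equivMapOfInjective _ K.subtype_injective
  let f₁ : K₁ →* N := (f.subgroupComap N).comp e.symm.toMonoidHom
  have h1 : LocallyDihedral K₁ := by
    refine hN K₁ f₁ (hK.mono ?_)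
    rintro _ ⟨x, hx, rfl⟩
    obtain ⟨y, rfl⟩ := e.surjective x
    refine ⟨y, ?_, rfl⟩
    have h2 : f₁ (e y) = 1 := hx
    simp only [f₁, MonoidHom.comp_apply, MulEquiv.coe_toMonoidHom, MulEquiv.symm_apply_apply] at h2
    exact congrArg Subtype.val h2
  refine hQ K ((QuotientGroup.mk' N).comp f) ?_
  have h2 : ((QuotientGroup.mk' N).comp f).ker = N.comap f := by
    rw [← MonoidHom.comap_ker, QuotientGroup.ker_mk']
  rw [h2]
  exact h1

theorem LiftsDihedral.directedUnion {Q : Type u} [Group Q] {S : Set (Subgroup Q)}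
    (hne : S.Nonempty) (hdir : DirectedOn (· ≤ ·) S) (hcover : ∀ g : Q, ∃ H ∈ S, g ∈ H)
    (hS : ∀ H ∈ S, LiftsDihedral Γ H) : LiftsDihedral Γ Q := by
  intro K f hK H hH hHfg
  have key : ∀ F : Finset Q, ∃ P ∈ S, ∀ x ∈ F, x ∈ P := by
    classical
    intro F
    induction F using Finset.induction_on with
    | empty => exact ⟨hne.some, hne.some_mem, by simp⟩
    | insert a F _ ih =>
      obtain ⟨P, hP, hF⟩ := ih
      obtain ⟨P', hP', ha⟩ := hcover a
      obtain ⟨P'', hP'', h1, h2⟩ := hdir P hP P' hP'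
      refine ⟨P'', hP'', fun x hx => ?_⟩
      rcases Finset.mem_insert.1 hx with rfl | hx
      · exact h2 ha
      · exact h1 (hF x hx)
  let g : H →* Q := f.comp (Subgroup.inclusion hH)
  have hg : g.range.FG := by
    have : Group.FG H := (Group.fg_iff_subgroup_fg _).2 hHfg
    exact (Group.fg_iff_subgroup_fg _).1 (Group.fg_range g)
  obtain ⟨F, hF⟩ := hg
  obtain ⟨P, hP, hFP⟩ := key F
  have hrange : ∀ x, g x ∈ P := fun x => by
    have : g.range ≤ P := by rw [← hF, Subgroup.closure_le]; exact hFP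
    exact this ⟨x, rfl⟩
  refine hS P hP H (g.codRestrict P hrange) (hK.mono ?_) H le_rfl hHfg
  rintro _ ⟨x, hx, rfl⟩
  exact ⟨Subgroup.inclusion hH x, congrArg Subtype.val (hx : g.codRestrict P hrange x = 1), rfl⟩

/-- The finitely generated subgroups of an elementary amenable group of small homology are (locally
finite)-by-dihedral. -/
theorem ElementaryAmenable.isLocallyFiniteByDihedral {k : Type u} [CommRing k] [Nontrivial k]
    (hΓ : SmallHomology k Γ) (hEA : ElementaryAmenable Γ) (H : Subgroup Γ) (hH : H.FG) :
    IsLocallyFiniteByDihedral H := by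
  -- The induction varies the target `Q` and keeps `Γ` fixed, so elementary amenability need not be
  -- passed to subgroups. At the end `Q` is `Γ` itself and the kernel is trivial.
  have key : ∀ (Q : Type u) [Group Q], ElementaryAmenable Q → LiftsDihedral Γ Q := by
    intro Q _ hQ
    induction hQ with
    | of_finite Q h => exact liftsDihedral_of_finite Q
    | of_comm Q h => exact liftsDihedral_of_comm hΓ Q h
    | extension Q N _ _ hN hQ => exact hN.extension N hQ
    | directedUnion Q S hne hdir hcover _ ih => exact LiftsDihedral.directedUnion hne hdir hcover ih
  refine key Γ hEA ⊤ Subgroup.topEquiv.toMonoidHom (fun H' hH' hfg => ?_) H le_top hH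
  have : H' = ⊥ := by
    rw [eq_bot_iff]
    refine hH'.trans ?_
    rintro _ ⟨x, hx, rfl⟩
    exact hx
  subst this
  exact (IsLocallyFinite.of_finite).isLocallyFiniteByDihedral

end Structure
end GroupDim

namespace GroupDim

/-! ### Finite presentation of one-edge groups -/

section FinitelyPresented

/-- The kernel of $B*\mathbb Z\to$ HNN is normally generated by one relation for each of the
finitely many elements of `C`: the map `g` back to the quotient shows that nothing else is killed.
-/
theorem isFinitelyPresented_hnnExtension {B : Type*} [Group B] [Finite B] (C D : Subgroup B)
    (φ : C ≃* D) : Group.IsFinitelyPresented (HNNExtension B C D φ) := by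
  let t' : Monoid.Coprod B (Multiplicative ℤ) := Monoid.Coprod.inr (Multiplicative.ofAdd 1)
  let f : Monoid.Coprod B (Multiplicative ℤ) →* HNNExtension B C D φ :=
    Monoid.Coprod.lift HNNExtension.of (zpowersHom _ HNNExtension.t)
  have hft : f t' = HNNExtension.t := by simp [f, t']
  have hfo : ∀ b, f (Monoid.Coprod.inl b) = HNNExtension.of b := fun b => by simp [f]
  let rel : C → Monoid.Coprod B (Multiplicative ℤ) := fun c =>
    t' * Monoid.Coprod.inl (c : B) * t'⁻¹ * (Monoid.Coprod.inl (φ c : B))⁻¹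
  let N : Subgroup (Monoid.Coprod B (Multiplicative ℤ)) := Subgroup.normalClosure (Set.range rel)
  let g : HNNExtension B C D φ →* Monoid.Coprod B (Multiplicative ℤ) ⧸ N :=
    HNNExtension.lift ((QuotientGroup.mk' N).comp Monoid.Coprod.inl) (QuotientGroup.mk' N t')
    fun c => by
      have h : QuotientGroup.mk' N (rel c) = 1 :=
        (QuotientGroup.eq_one_iff _).2 (Subgroup.subset_normalClosure ⟨c, rfl⟩)
      simp only [rel, map_mul, map_inv] at h
      rw [mul_inv_eq_one, mul_inv_eq_iff_eq_mul] at h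
      exact h
  have hg : g.comp f = QuotientGroup.mk' N := by
    refine Monoid.Coprod.hom_ext ?_ ?_
    · ext b; simp [hfo, g]
    · refine MonoidHom.ext_mint ?_
      change g (f t') = _
      simp [hft, g, t']
  refine Group.IsFinitelyPresented.of_surjective f (fun x => ?_)
    ⟨Set.range rel, Set.finite_range _, le_antisymm ?_ fun x hx => ?_⟩
  · induction x using HNNExtension.induction_on with
    | of b => exact ⟨_, hfo b⟩
    | t => exact ⟨_, hft⟩
    | mul x y hx hy =>
      obtain ⟨x, rfl⟩ := hx
      obtain ⟨y, rfl⟩ := hy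
      exact ⟨x * y, map_mul _ _ _⟩
    | inv x hx =>
      obtain ⟨x, rfl⟩ := hx
      exact ⟨x⁻¹, map_inv _ _⟩
  · refine Subgroup.normalClosure_le_normal ?_
    rintro _ ⟨c, rfl⟩
    simp only [SetLike.mem_coe, MonoidHom.mem_ker, rel, map_mul, map_inv, hft, hfo,
      HNNExtension.equiv_eq_conj]
    group
  · have h := DFunLike.congr_fun hg x
    rw [MonoidHom.comp_apply, MonoidHom.mem_ker.1 hx, map_one] at h
    exact (QuotientGroup.eq_one_iff x).1 h.symm

theorem isFinitelyPresented_pushoutI {C : Type*} [Group C] [Finite C] {B : Fin 2 → Type*}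
    [∀ i, Group (B i)] [∀ i, Finite (B i)] (φ : ∀ i, C →* B i) :
    Group.IsFinitelyPresented (Monoid.PushoutI φ) := by
  let f : Monoid.Coprod (B 0) (B 1) →* Monoid.PushoutI φ :=
    Monoid.Coprod.lift (Monoid.PushoutI.of 0) (Monoid.PushoutI.of 1)
  have hf0 : ∀ b, f (Monoid.Coprod.inl b) = Monoid.PushoutI.of 0 b := fun b => by simp [f]
  have hf1 : ∀ b, f (Monoid.Coprod.inr b) = Monoid.PushoutI.of 1 b := fun b => by simp [f]
  let rel : C → Monoid.Coprod (B 0) (B 1) := fun c =>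
    Monoid.Coprod.inl (φ 0 c) * (Monoid.Coprod.inr (φ 1 c))⁻¹
  let N : Subgroup (Monoid.Coprod (B 0) (B 1)) := Subgroup.normalClosure (Set.range rel)
  let q : ∀ i, B i →* Monoid.Coprod (B 0) (B 1) ⧸ N := fun i => match i with
    | 0 => (QuotientGroup.mk' N).comp Monoid.Coprod.inl
    | 1 => (QuotientGroup.mk' N).comp Monoid.Coprod.inr
  let g : Monoid.PushoutI φ →* Monoid.Coprod (B 0) (B 1) ⧸ N :=
    Monoid.PushoutI.lift q ((q 0).comp (φ 0)) fun i => by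
      match i with
      | 0 => rfl
      | 1 =>
        ext c
        have h : QuotientGroup.mk' N (rel c) = 1 :=
          (QuotientGroup.eq_one_iff _).2 (Subgroup.subset_normalClosure ⟨c, rfl⟩)
        simp only [rel, map_mul, map_inv] at h
        rw [mul_inv_eq_one] at h
        exact h.symm
  have hg : g.comp f = QuotientGroup.mk' N := by
    refine Monoid.Coprod.hom_ext ?_ ?_
    · ext b; simp [hf0, g, q]
    · ext b; simp [hf1, g, q]
  refine Group.IsFinitelyPresented.of_surjective f (fun x => ?_)
    ⟨Set.range rel, Set.finite_range _, le_antisymm ?_ fun x hx => ?_⟩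
  · induction x using Monoid.PushoutI.induction_on with
    | of i b =>
      match i with
      | 0 => exact ⟨_, hf0 b⟩
      | 1 => exact ⟨_, hf1 b⟩
    | base c => exact ⟨_, (hf0 (φ 0 c)).trans (Monoid.PushoutI.of_apply_eq_base φ 0 c)⟩
    | mul x y hx hy =>
      obtain ⟨x, rfl⟩ := hx
      obtain ⟨y, rfl⟩ := hy
      exact ⟨x * y, map_mul _ _ _⟩
  · refine Subgroup.normalClosure_le_normal ?_
    rintro _ ⟨c, rfl⟩
    simp only [SetLike.mem_coe, MonoidHom.mem_ker, rel, map_mul, map_inv, hf0, hf1,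
      Monoid.PushoutI.of_apply_eq_base, mul_inv_cancel]
  · have h := DFunLike.congr_fun hg x
    rw [MonoidHom.comp_apply, MonoidHom.mem_ker.1 hx, map_one] at h
    exact (QuotientGroup.eq_one_iff x).1 h.symm

end FinitelyPresented

/-! ### One-edge groups with invertible vertex orders -/

section OneEdge

variable (k : Type u) [CommRing k]

/-- Fundamental groups of graphs of groups with a single edge whose vertex groups are finite of
order invertible in `k`. -/
def IsOneEdgeGroup (P : Type u) [Group P] : Prop :=
  (∃ (B : Type u) (_ : Group B) (_ : Finite B) (A A' : Subgroup B) (φ : A ≃* A'),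
    IsUnit (Nat.card B : k) ∧ Nonempty (P ≃* HNNExtension B A A' φ)) ∨
  ∃ (C : Type u) (_ : Group C) (B : Fin 2 → Type u) (_ : ∀ i, Group (B i)) (_ : ∀ i, Finite (B i))
    (φ : ∀ i, C →* B i), (∀ i, IsUnit (Nat.card (B i) : k)) ∧ (∀ i, Function.Injective (φ i)) ∧
      Nonempty (P ≃* Monoid.PushoutI φ)

variable {k}

namespace IsOneEdgeGroup

theorem of_mulEquiv {P Q : Type u} [Group P] [Group Q] (e : P ≃* Q)
    (h : IsOneEdgeGroup k P) : IsOneEdgeGroup k Q := by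
  refine h.imp ?_ ?_
  · rintro ⟨B, _, _, A, A', φ, hB, ⟨ε⟩⟩
    exact ⟨B, _, ‹_›, A, A', φ, hB, ⟨e.symm.trans ε⟩⟩
  · rintro ⟨C, _, B, _, _, φ, hB, hφ, ⟨ε⟩⟩
    exact ⟨C, _, B, _, ‹_›, φ, hB, hφ, ⟨e.symm.trans ε⟩⟩

variable {P : Type u} [Group P]

theorem isFinitelyPresented (h : IsOneEdgeGroup k P) : Group.IsFinitelyPresented P := by
  obtain ⟨B, _, _, A, A', φ, -, ⟨ε⟩⟩ | ⟨C, _, B, _, _, φ, -, hφ, ⟨ε⟩⟩ := h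
  · have := isFinitelyPresented_hnnExtension A A' φ
    exact Group.IsFinitelyPresented.equiv ε.symm
  · have : Finite C := Finite.of_injective _ (hφ 0)
    have := isFinitelyPresented_pushoutI φ
    exact Group.IsFinitelyPresented.equiv ε.symm

theorem cd_le_one (h : IsOneEdgeGroup k P) : cd k P ≤ 1 := by
  obtain ⟨B, _, _, A, A', φ, hB, ⟨ε⟩⟩ | ⟨C, _, B, _, _, φ, hB, hφ, ⟨ε⟩⟩ := h
  · exact cd_le_one_of_mulEquiv_hnnExtension hB A A' φ ε
  · exact cd_le_one_of_mulEquiv_pushoutI hB φ hφ ε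

theorem isHNNExtensionOfFinite_or_isAmalgamOfFinite (h : IsOneEdgeGroup k P) :
    IsHNNExtensionOfFinite P ∨ IsAmalgamOfFinite P := by
  refine h.imp ?_ ?_
  · rintro ⟨B, _, _, A, A', φ, -, h⟩
    exact ⟨B, _, ‹_›, A, A', φ, h⟩
  · rintro ⟨C, _, B, _, _, φ, -, hφ, h⟩
    exact ⟨C, _, B, _, ‹_›, φ, hφ, h⟩

theorem hnnExtension {B : Type u} [Group B] [Finite B]
    (hB : IsUnit (Nat.card B : k)) (C D : Subgroup B) (φ : C ≃* D) :
    IsOneEdgeGroup k (HNNExtension B C D φ) :=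
  Or.inl ⟨B, _, ‹_›, C, D, φ, hB, ⟨MulEquiv.refl _⟩⟩

theorem pushoutI {C : Type u} [Group C] {B : Fin 2 → Type u} [∀ i, Group (B i)]
    [∀ i, Finite (B i)] (hB : ∀ i, IsUnit (Nat.card (B i) : k)) (φ : ∀ i, C →* B i)
    (hφ : ∀ i, Function.Injective (φ i)) : IsOneEdgeGroup k (Monoid.PushoutI φ) :=
  Or.inr ⟨C, _, B, _, ‹_›, φ, hB, hφ, ⟨MulEquiv.refl _⟩⟩

end IsOneEdgeGroup

end OneEdge

end GroupDim

namespace GroupDim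

/-! ### Factoring maps through approximating groups -/

section Factorization

/-- Every homomorphism from a finitely presented group to `H` factors through the fundamental group
of a graph of finite groups with a single edge. -/
def FactorsThroughOneEdge (k : Type u) [CommRing k] (H : Type u) [Group H] : Prop :=
  ∀ (X : Type u) [Group X] [Group.IsFinitelyPresented X] (f : X →* H),
    ∃ (P : Type u) (_ : Group P) (a : X →* P) (b : P →* H), IsOneEdgeGroup k P ∧ b.comp a = f

variable {k : Type u} [CommRing k] {H : Type u} [Group H]

theorem IsOneEdgeGroup.factorsThroughOneEdge (h : IsOneEdgeGroup k H) :
    FactorsThroughOneEdge k H :=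
  fun _ _ _ f => ⟨H, _, f, MonoidHom.id H, h, rfl⟩

variable {Λ Y : Type*} {l : Filter Λ} {P : Λ → Type u} [∀ i, Group (P i)]

/-- The relations that eventually hold between the elements `e i y`. -/
def eventualRelations (l : Filter Λ) (e : ∀ i, Y → P i) : Subgroup (FreeGroup Y) where
  carrier := {w | ∀ᶠ i in l, FreeGroup.lift (e i) w = 1}
  one_mem' := by simp
  mul_mem' {v w} hv hw := by
    filter_upwards [hv, hw] with i h1 h2
    rw [map_mul, h1, h2, one_mul]
  inv_mem' {w} hw := by
    filter_upwards [hw] with i h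
    rw [map_inv, h, inv_one]

theorem mem_eventualRelations {e : ∀ i, Y → P i} {w : FreeGroup Y} :
    w ∈ eventualRelations l e ↔ ∀ᶠ i in l, FreeGroup.lift (e i) w = 1 := Iff.rfl

instance (e : ∀ i, Y → P i) : (eventualRelations l e).Normal where
  conj_mem w hw v := by
    rw [mem_eventualRelations] at hw ⊢
    filter_upwards [hw] with i h
    rw [map_mul, map_mul, h, mul_one, ← map_mul, mul_inv_cancel, map_one]

theorem mk_eq_mk_of_eventually {e : ∀ i, Y → P i} {v w : FreeGroup Y}
    (h : ∀ᶠ i in l, FreeGroup.lift (e i) v = FreeGroup.lift (e i) w) :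
    (v : FreeGroup Y ⧸ eventualRelations l e) = w := by
  rw [QuotientGroup.eq, mem_eventualRelations]
  filter_upwards [h] with i hi
  rw [map_mul, map_inv, hi, inv_mul_cancel]

variable {e : ∀ i, Y → P i} {π : ∀ i, P i →* H} {y : Y → H}

theorem eventually_map_lift_eq (he : ∀ z, ∀ᶠ i in l, π i (e i z) = y z) (w : FreeGroup Y) :
    ∀ᶠ i in l, π i (FreeGroup.lift (e i) w) = FreeGroup.lift y w := by
  induction w using FreeGroup.induction_on with
  | C1 => simp
  | of z => simpa using he z
  | inv_of z ih =>
    filter_upwards [ih] with i h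
    rw [map_inv, map_inv, map_inv, h]
  | mul v w hv hw =>
    filter_upwards [hv, hw] with i h1 h2
    rw [map_mul, map_mul, map_mul, h1, h2]

variable [l.NeBot]

/-- The homomorphism to `H` induced on the group of eventual relations. -/
def eventualHom (he : ∀ z, ∀ᶠ i in l, π i (e i z) = y z) :
    FreeGroup Y ⧸ eventualRelations l e →* H :=
  QuotientGroup.lift _ (FreeGroup.lift y) fun w hw => by
    obtain ⟨i, h1, h2⟩ := ((mem_eventualRelations.1 hw).and (eventually_map_lift_eq he w)).exists
    rw [MonoidHom.mem_ker, ← h2, h1, map_one]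

/-- By injectivity every relation of `H` holds eventually in `P i`. A finitely presented group
imposes finitely many relators and finitely many values, all of which are correct at a common index.
No maps between the `P i` are needed. -/
theorem FactorsThroughOneEdge.of_eventually (hP : ∀ i, IsOneEdgeGroup k (P i))
    (he : ∀ z, ∀ᶠ i in l, π i (e i z) = y z)
    (hsurj : Function.Surjective (FreeGroup.lift y))
    (hinj : Function.Injective (eventualHom he)) : FactorsThroughOneEdge k H := by
  intro X _ hX f
  obtain ⟨n, φ, hφ, S, hS, hker⟩ := hX.out
  choose w hw using fun j : Fin n => hsurj (f (φ (FreeGroup.of j)))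
  have hσ : (FreeGroup.lift y).comp (FreeGroup.lift w) = f.comp φ := by
    ext j
    simp [hw]
  have h1 : ∀ s ∈ S, ∀ᶠ i in l, FreeGroup.lift (e i) (FreeGroup.lift w s) = 1 := fun s hs => by
    rw [← mem_eventualRelations, ← QuotientGroup.eq_one_iff]
    refine hinj ?_
    rw [map_one]
    change ((FreeGroup.lift y).comp (FreeGroup.lift w)) s = 1
    have : s ∈ φ.ker := hker ▸ Subgroup.subset_normalClosure hs
    rw [hσ, MonoidHom.comp_apply, MonoidHom.mem_ker.1 this, map_one]
  have h2 : ∀ j, ∀ᶠ i in l, π i (FreeGroup.lift (e i) (w j)) = f (φ (FreeGroup.of j)) :=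
    fun j => by simpa only [hw] using eventually_map_lift_eq he (w j)
  obtain ⟨i, h1, h2⟩ := (((Filter.eventually_all_finite hS).2 h1).and
    (Filter.eventually_all.2 h2)).exists
  let a : FreeGroup (Fin n) →* P i := (FreeGroup.lift (e i)).comp (FreeGroup.lift w)
  have ha : φ.ker ≤ a.ker := by
    rw [← hker]
    exact Subgroup.normalClosure_le_normal fun s hs => h1 s hs
  have hb : (π i).comp a = f.comp φ := by
    ext j
    simpa [a] using h2 j
  refine ⟨P i, _, φ.liftOfSurjective hφ ⟨a, ha⟩, π i, hP i, ?_⟩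
  rw [← MonoidHom.cancel_right hφ, MonoidHom.comp_assoc, MonoidHom.liftOfRightInverse_comp, hb]

end Factorization

/-! ### Recognizing extensions of $\mathbb Z$ and $D_\infty$ -/

section Injectivity

variable {H E : Type*} [Group H] [Group E]

/-- The conjugation relations bring each element of `E` to the form $t'^n\,\iota(\tau)$, and its
image in `H` determines first `n` and then `τ`. -/
theorem injective_of_normal_of_zpow {T : Subgroup H} [T.Normal] {t : H}
    (ht : ∀ n : ℤ, t ^ n ∈ T → n = 0) {π : E →* H} {ι : T →* E} {t' : E}
    (hι : ∀ τ, π (ι τ) = τ) (ht' : π t' = t)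
    (hconj : ∀ τ τ' : T, (τ' : H) = t * τ * t⁻¹ → t' * ι τ * t'⁻¹ = ι τ')
    (hgen : Subgroup.closure (Set.range ι ∪ {t'}) = ⊤) : Function.Injective π := by
  have hc : ∀ τ : T, t' * ι τ * t'⁻¹ ∈ ι.range := fun τ =>
    ⟨⟨t * τ * t⁻¹, Subgroup.Normal.conj_mem ‹_› _ τ.2 _⟩, (hconj _ _ rfl).symm⟩
  have hc' : ∀ τ : T, t'⁻¹ * ι τ * t' ∈ ι.range := fun τ => by
    refine ⟨⟨t⁻¹ * τ * t, by simpa using Subgroup.Normal.conj_mem ‹T.Normal› _ τ.2 t⁻¹⟩, ?_⟩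
    rw [← hconj ⟨t⁻¹ * τ * t, by simpa using Subgroup.Normal.conj_mem ‹T.Normal› _ τ.2 t⁻¹⟩ τ
      (by simp only; group)]
    group
  have hmem : ∀ x : E, ∃ (n : ℤ) (τ : T), x = t' ^ n * ι τ := fun x => by
    have hx : x ∈ Subgroup.closure (Set.range ι ∪ {t'}) := hgen ▸ Subgroup.mem_top x
    induction hx using Subgroup.closure_induction_right with
    | one => exact ⟨0, 1, by simp⟩
    | mul_right x s _ hs ih =>
      obtain ⟨n, τ, rfl⟩ := ih
      obtain ⟨σ, rfl⟩ | rfl := hs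
      · exact ⟨n, τ * σ, by rw [map_mul, mul_assoc]⟩
      · obtain ⟨σ, hσ⟩ := hc' τ
        refine ⟨n + 1, σ, ?_⟩
        rw [hσ, zpow_add_one]
        group
    | mul_inv_cancel x s _ hs ih =>
      obtain ⟨n, τ, rfl⟩ := ih
      obtain ⟨σ, rfl⟩ | rfl := hs
      · exact ⟨n, τ * σ⁻¹, by rw [map_mul, map_inv, mul_assoc]⟩
      · obtain ⟨σ, hσ⟩ := hc τ
        refine ⟨n - 1, σ, ?_⟩
        rw [hσ, zpow_sub_one]
        group
  refine (injective_iff_map_eq_one π).2 fun x hx => ?_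
  obtain ⟨n, τ, rfl⟩ := hmem x
  rw [map_mul, map_zpow, ht', hι] at hx
  obtain rfl := ht n (by rw [eq_inv_of_mul_eq_one_left hx]; exact inv_mem τ.2)
  obtain rfl : τ = 1 := Subtype.ext (by simpa using hx)
  simp

/-- Normal form in a quotient of the infinite dihedral group: `R 0` inverts the rotation `R 1 * R
0`. -/
theorem exists_zpow_of_mul_self_eq_one {Q : Type*} [Group Q] {R : Fin 2 → Q}
    (hR : ∀ i, R i * R i = 1) (hgen : Subgroup.closure (Set.range R) = ⊤) (x : Q) :
    ∃ n : ℤ, x = (R 1 * R 0) ^ n ∨ x = (R 1 * R 0) ^ n * R 0 := by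
  have hinv : ∀ i, (R i)⁻¹ = R i := fun i => inv_eq_of_mul_eq_one_left (hR i)
  have hs : ∀ n : ℤ, R 0 * (R 1 * R 0) ^ n = (R 1 * R 0) ^ (-n) * R 0 := fun n => by
    have h : SemiconjBy (R 0) (R 1 * R 0) (R 1 * R 0)⁻¹ := by
      rw [SemiconjBy, mul_inv_rev, hinv, hinv, mul_assoc]
    rw [zpow_neg, ← inv_zpow]
    exact h.zpow_right n
  have hR1 : R 1 = R 1 * R 0 * R 0 := by rw [mul_assoc, hR, mul_one]
  have key : ∀ (i : Fin 2) (x : Q),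
      (∃ n : ℤ, x = (R 1 * R 0) ^ n ∨ x = (R 1 * R 0) ^ n * R 0) →
      ∃ n : ℤ, R i * x = (R 1 * R 0) ^ n ∨ R i * x = (R 1 * R 0) ^ n * R 0 := by
    intro i x hx
    have h0 : ∃ n : ℤ, R 0 * x = (R 1 * R 0) ^ n ∨ R 0 * x = (R 1 * R 0) ^ n * R 0 := by
      obtain ⟨n, rfl | rfl⟩ := hx
      · exact ⟨-n, Or.inr (hs n)⟩
      · exact ⟨-n, Or.inl (by rw [← mul_assoc, hs, mul_assoc, hR, mul_one])⟩
    match i with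
    | 0 => exact h0
    | 1 =>
      obtain ⟨n, h | h⟩ := h0
      · refine ⟨1 + n, Or.inl ?_⟩
        rw [zpow_add, zpow_one, ← h]
        nth_rw 1 [hR1]
        group
      · refine ⟨1 + n, Or.inr ?_⟩
        rw [zpow_add, zpow_one, mul_assoc, ← h]
        nth_rw 1 [hR1]
        group
  have hx : x ∈ Subgroup.closure (Set.range R) := hgen ▸ Subgroup.mem_top x
  induction hx using Subgroup.closure_induction_left with
  | one => exact ⟨0, Or.inl (by simp)⟩
  | mul_left s hs x _ ih =>
    obtain ⟨i, rfl⟩ := hs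
    exact key i x ih
  | inv_mul_cancel s hs x _ ih =>
    obtain ⟨i, rfl⟩ := hs
    rw [hinv]
    exact key i x ih

/-- The common copy `M` of `T` is normal in `E`, and `E ⧸ M` is generated by two elements of trivial
square. The dihedral normal form and `hn`, `hn'` put the kernel of `π` inside `M`, where `π` is
injective. -/
theorem injective_of_normal_of_dihedral {T : Subgroup H} [T.Normal] {D : Fin 2 → Subgroup H}
    (hTD : ∀ i, T ≤ D i) {r : Fin 2 → H} (hr : ∀ i, r i ∈ D i) (hrT : ∀ i, r i * r i ∈ T)
    (hD : ∀ i, ∀ h ∈ D i, h ∈ T ∨ h * (r i)⁻¹ ∈ T)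
    (hn : ∀ n : ℤ, (r 1 * r 0) ^ n ∈ T → n = 0) (hn' : ∀ n : ℤ, (r 1 * r 0) ^ n * r 0 ∉ T)
    {π : E →* H} {ι : ∀ i, D i →* E} (hι : ∀ i d, π (ι i d) = d)
    (hιT : ∀ τ (hτ : τ ∈ T), ι 0 ⟨τ, hTD 0 hτ⟩ = ι 1 ⟨τ, hTD 1 hτ⟩)
    (hgen : Subgroup.closure (⋃ i, Set.range (ι i)) = ⊤) : Function.Injective π := by
  have hιT' : ∀ i τ (hτ : τ ∈ T), ι i ⟨τ, hTD i hτ⟩ = ι 0 ⟨τ, hTD 0 hτ⟩ := fun i τ hτ => by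
    match i with
    | 0 => rfl
    | 1 => exact (hιT τ hτ).symm
  let M : Subgroup E := (T.subgroupOf (D 0)).map (ι 0)
  have hM : ∀ x, x ∈ M ↔ ∃ τ, ∃ hτ : τ ∈ T, ι 0 ⟨τ, hTD 0 hτ⟩ = x := fun x => by
    constructor
    · rintro ⟨⟨τ, hτ⟩, h, rfl⟩
      exact ⟨τ, h, rfl⟩
    · rintro ⟨τ, hτ, rfl⟩
      exact ⟨⟨τ, hTD 0 hτ⟩, hτ, rfl⟩
  have hMmem : ∀ i (d : D i), (d : H) ∈ T → ι i d ∈ M := fun i d hd =>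
    (hM _).2 ⟨d, hd, (hιT' i d hd).symm⟩
  have hconj : ∀ i (d : D i), ∀ m ∈ M, ι i d * m * (ι i d)⁻¹ ∈ M := fun i d m hm => by
    obtain ⟨τ, hτ, rfl⟩ := (hM m).1 hm
    rw [← hιT' i τ hτ, ← map_mul, ← map_inv, ← map_mul]
    exact hMmem i _ (Subgroup.Normal.conj_mem ‹_› τ hτ d)
  have : M.Normal := by
    rw [← Subgroup.normalizer_eq_top_iff, eq_top_iff, ← hgen, Subgroup.closure_le,
      Set.iUnion_subset_iff]
    rintro i _ ⟨d, rfl⟩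
    rw [SetLike.mem_coe, Subgroup.mem_normalizer_iff]
    refine fun m => ⟨hconj i d m, fun h => ?_⟩
    have := hconj i d⁻¹ _ h
    rw [map_inv] at this
    convert this using 1
    group
  let R : Fin 2 → E ⧸ M := fun i => QuotientGroup.mk' M (ι i ⟨r i, hr i⟩)
  have hR : ∀ i, R i * R i = 1 := fun i => by
    rw [← map_mul, ← map_mul]
    exact (QuotientGroup.eq_one_iff _).2 (hMmem i _ (hrT i))
  have hgen' : Subgroup.closure (Set.range R) = ⊤ := by
    rw [← (MonoidHom.range_eq_top (f := QuotientGroup.mk' M)).2 (QuotientGroup.mk'_surjective M),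
      MonoidHom.range_eq_map, ← hgen, MonoidHom.map_closure]
    refine le_antisymm (Subgroup.closure_mono ?_) ((Subgroup.closure_le _).2 ?_)
    · rintro _ ⟨i, rfl⟩
      exact ⟨_, Set.mem_iUnion.2 ⟨i, ⟨r i, hr i⟩, rfl⟩, rfl⟩
    · rintro _ ⟨_, h, rfl⟩
      obtain ⟨i, d, rfl⟩ := Set.mem_iUnion.1 h
      obtain h | h := hD i d d.2
      · rw [QuotientGroup.mk'_apply, (QuotientGroup.eq_one_iff _).2 (hMmem i d h)]
        exact one_mem _
      · have : QuotientGroup.mk' M (ι i (d * ⟨r i, hr i⟩⁻¹)) = 1 :=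
          (QuotientGroup.eq_one_iff _).2 (hMmem i _ h)
        rw [map_mul, map_mul, map_inv, map_inv, mul_inv_eq_one] at this
        rw [this]
        exact Subgroup.subset_closure ⟨i, rfl⟩
  refine (injective_iff_map_eq_one π).2 fun x hx => ?_
  let u : E := ι 1 ⟨r 1, hr 1⟩ * ι 0 ⟨r 0, hr 0⟩
  have hu : π u = r 1 * r 0 := by rw [map_mul, hι, hι]
  have hπM : ∀ m ∈ M, π m ∈ T := fun m hm => by
    obtain ⟨τ, hτ, rfl⟩ := (hM m).1 hm
    rw [hι]
    exact hτ
  obtain ⟨n, h | h⟩ := exists_zpow_of_mul_self_eq_one hR hgen' (QuotientGroup.mk' M x)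
  · have h1 : x⁻¹ * u ^ n ∈ M := QuotientGroup.eq.1 h
    have h2 := hπM _ h1
    rw [map_mul, map_inv, hx, inv_one, one_mul, map_zpow, hu] at h2
    obtain rfl := hn n h2
    rw [zpow_zero, mul_one, inv_mem_iff] at h1
    obtain ⟨τ, hτ, rfl⟩ := (hM x).1 h1
    rw [hι] at hx
    obtain rfl : τ = 1 := hx
    exact map_one _
  · have h1 : x⁻¹ * (u ^ n * ι 0 ⟨r 0, hr 0⟩) ∈ M := QuotientGroup.eq.1 h
    have h2 := hπM _ h1
    rw [map_mul, map_inv, hx, inv_one, one_mul, map_mul, map_zpow, hu, hι] at h2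
    exact absurd h2 (hn' n)

end Injectivity

end GroupDim

namespace GroupDim

/-! ### Approximation by finite subgroups -/

section Truncation

variable {H : Type*} [Group H]

/-- The subgroup of `D` generated by the elements of `D` in a finite set. -/
def truncation (D : Subgroup H) (s : Finset H) : Subgroup H := Subgroup.closure (s ∩ D)

theorem IsLocallyFinite.finite_truncation {D : Subgroup H} (hD : IsLocallyFinite D)
    (s : Finset H) : Finite (truncation D s) := by
  have := hD (Subgroup.closure (Subtype.val ⁻¹' (s : Set H))) ((Subgroup.fg_iff _).2
    ⟨_, rfl, s.finite_toSet.preimage Subtype.val_injective.injOn⟩)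
  have h : truncation D s = (Subgroup.closure (Subtype.val ⁻¹' (s : Set H))).map D.subtype := by
    rw [MonoidHom.map_closure, truncation]
    congr 1
    ext x
    constructor
    · exact fun h => ⟨⟨x, h.2⟩, h.1, rfl⟩
    · rintro ⟨y, h, rfl⟩
      exact ⟨h, y.2⟩
  rw [h]
  exact Set.Finite.image _ (Set.toFinite _)

theorem eventually_mem_truncation {D : Subgroup H} {x : H} (hx : x ∈ D) :
    ∀ᶠ s in Filter.atTop, x ∈ truncation D s := by
  filter_upwards [Filter.eventually_ge_atTop {x}] with s hs
  exact Subgroup.subset_closure ⟨hs (Finset.mem_singleton_self x), hx⟩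

/-- The isomorphism between subgroups of `B` induced by conjugation with `t`. -/
def conjEquiv (B : Subgroup H) (t : H) :
    (B.comap (MulAut.conj t).toMonoidHom).subgroupOf B ≃*
      (B.comap (MulAut.conj t⁻¹).toMonoidHom).subgroupOf B where
  toFun a := ⟨⟨t * a * t⁻¹, a.2⟩, by
    change t⁻¹ * (t * (a : H) * t⁻¹) * t⁻¹⁻¹ ∈ B
    convert a.1.2 using 1
    group⟩
  invFun a := ⟨⟨t⁻¹ * a * t⁻¹⁻¹, a.2⟩, by
    change t * (t⁻¹ * (a : H) * t⁻¹⁻¹) * t⁻¹ ∈ B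
    convert a.1.2 using 1
    group⟩
  left_inv a := by
    ext
    change t⁻¹ * (t * (a : H) * t⁻¹) * t⁻¹⁻¹ = a
    group
  right_inv a := by
    ext
    change t * (t⁻¹ * (a : H) * t⁻¹⁻¹) * t⁻¹ = a
    group
  map_mul' a b := by
    ext
    change t * ((a : H) * b) * t⁻¹ = t * a * t⁻¹ * (t * b * t⁻¹)
    group

theorem coe_conjEquiv (B : Subgroup H) (t : H)
    (a : (B.comap (MulAut.conj t).toMonoidHom).subgroupOf B) :
    ((conjEquiv B t a : B) : H) = t * a * t⁻¹ := rfl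

end Truncation

variable {k : Type u} [CommRing k] {H : Type u} [Group H]

section Cyclic

/-- The HNN extension of a subgroup along the isomorphism induced by conjugation with `t`. -/
abbrev ConjHNN (B : Subgroup H) (t : H) : Type u := HNNExtension B _ _ (conjEquiv B t)

/-- The canonical homomorphism from the HNN extension defined by conjugation. -/
def ConjHNN.toGroup (B : Subgroup H) (t : H) : ConjHNN B t →* H :=
  HNNExtension.lift B.subtype t fun a => by
    rw [Subgroup.coe_subtype, coe_conjEquiv, inv_mul_cancel_right]

theorem ConjHNN.toGroup_of (B : Subgroup H) (t : H) (x : B) :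
    ConjHNN.toGroup B t (HNNExtension.of x) = x := HNNExtension.lift_of ..

theorem ConjHNN.toGroup_t (B : Subgroup H) (t : H) :
    ConjHNN.toGroup B t HNNExtension.t = t := HNNExtension.lift_t ..

theorem ConjHNN.conj_of {B : Subgroup H} {t : H} {x x' : B} (h : (x' : H) = t * x * t⁻¹) :
    (HNNExtension.t : ConjHNN B t) * HNNExtension.of x * HNNExtension.t⁻¹ = HNNExtension.of x' := by
  have hx : x ∈ (B.comap (MulAut.conj t).toMonoidHom).subgroupOf B := by
    change t * (x : H) * t⁻¹ ∈ B
    exact h ▸ x'.2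
  have := HNNExtension.equiv_eq_conj (φ := conjEquiv B t) ⟨x, hx⟩
  rw [← this]
  congr 1
  exact Subtype.ext h.symm

open Classical in
/-- The element of the HNN extension of a truncation defined by an element of `T` or by the stable
letter. -/
noncomputable def cyclicApprox (T : Subgroup H) (t : H) (s : Finset H) :
    T ⊕ Unit → ConjHNN (truncation T s) t
  -- The default 1 is harmless: each `τ` lies in all sufficiently large truncations.
  | .inl τ => if h : (τ : H) ∈ truncation T s then HNNExtension.of ⟨τ, h⟩ else 1
  | .inr _ => HNNExtension.t

theorem cyclicApprox_inl {T : Subgroup H} (t : H) {s : Finset H} {τ : T}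
    (h : (τ : H) ∈ truncation T s) :
    cyclicApprox T t s (.inl τ) = HNNExtension.of ⟨τ, h⟩ := dif_pos h

theorem eventually_toGroup_cyclicApprox (T : Subgroup H) (t : H) (z : T ⊕ Unit) :
    ∀ᶠ s in Filter.atTop, ConjHNN.toGroup _ t (cyclicApprox T t s z) =
      Sum.elim Subtype.val (fun _ => t) z := by
  match z with
  | .inl τ =>
    filter_upwards [eventually_mem_truncation τ.2] with s hs
    rw [cyclicApprox_inl t hs]
    exact ConjHNN.toGroup_of ..
  | .inr _ => exact Filter.Eventually.of_forall fun s => ConjHNN.toGroup_t ..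

/-- The multiplication table of `T` and conjugation by `t` hold in the HNN extension once the
elements involved lie in the finite truncation. These relations present `H`, so the eventual
relations are exactly those of `H`. -/
theorem factorsThroughOneEdge_of_zpow
    (hcard : ∀ B : Subgroup H, Finite B → IsUnit (Nat.card B : k)) {T : Subgroup H} [T.Normal]
    (hT : IsLocallyFinite T) {t : H} (ht : ∀ n : ℤ, t ^ n ∈ T → n = 0)
    (hgen : ∀ x, ∃ n : ℤ, x * (t ^ n)⁻¹ ∈ T) : FactorsThroughOneEdge k H := by
  have := hT.finite_truncation
  refine FactorsThroughOneEdge.of_eventually (l := Filter.atTop)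
    (fun s => IsOneEdgeGroup.hnnExtension (hcard (truncation T s) inferInstance) _ _ _)
    (eventually_toGroup_cyclicApprox T t) (fun x => ?_) ?_
  · obtain ⟨n, hn⟩ := hgen x
    refine ⟨FreeGroup.of (.inl ⟨_, hn⟩) * FreeGroup.of (.inr ()) ^ n, ?_⟩
    simp
  let N := eventualRelations Filter.atTop (cyclicApprox T t)
  let ι : T →* FreeGroup (T ⊕ Unit) ⧸ N := MonoidHom.mk'
    (fun τ => QuotientGroup.mk (FreeGroup.of (.inl τ))) fun σ τ => by
      rw [← QuotientGroup.mk_mul]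
      refine mk_eq_mk_of_eventually ?_
      filter_upwards [eventually_mem_truncation σ.2, eventually_mem_truncation τ.2] with s h1 h2
      rw [map_mul, FreeGroup.lift_apply_of, FreeGroup.lift_apply_of, FreeGroup.lift_apply_of,
        cyclicApprox_inl t h1, cyclicApprox_inl t h2, cyclicApprox_inl t (mul_mem h1 h2),
        ← map_mul]
      rfl
  refine injective_of_normal_of_zpow (ι := ι) (t' := QuotientGroup.mk (FreeGroup.of (.inr ()))) ht
    (fun τ => FreeGroup.lift_apply_of ..) (FreeGroup.lift_apply_of ..) (fun τ τ' h => ?_) ?_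
  · change QuotientGroup.mk (FreeGroup.of (.inr ()) * FreeGroup.of (.inl τ) *
      (FreeGroup.of (.inr ()))⁻¹) = (QuotientGroup.mk (FreeGroup.of (.inl τ')) : _ ⧸ N)
    refine mk_eq_mk_of_eventually ?_
    filter_upwards [eventually_mem_truncation τ.2, eventually_mem_truncation τ'.2] with s h1 h2
    rw [map_mul, map_mul, map_inv (FreeGroup.lift (cyclicApprox T t s)),
      FreeGroup.lift_apply_of, FreeGroup.lift_apply_of,
      FreeGroup.lift_apply_of, cyclicApprox_inl t h1, cyclicApprox_inl t h2]
    exact ConjHNN.conj_of h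
  · rw [← (MonoidHom.range_eq_top (f := QuotientGroup.mk' N)).2 (QuotientGroup.mk'_surjective N),
      MonoidHom.range_eq_map, ← FreeGroup.closure_range_of, MonoidHom.map_closure]
    refine le_antisymm ((Subgroup.closure_mono ?_)) (Subgroup.closure_mono ?_)
    · rintro _ (⟨τ, rfl⟩ | rfl)
      · exact ⟨_, ⟨.inl τ, rfl⟩, rfl⟩
      · exact ⟨_, ⟨.inr (), rfl⟩, rfl⟩
    · rintro _ ⟨_, ⟨τ | _, rfl⟩, rfl⟩
      · exact Or.inl ⟨τ, rfl⟩
      · exact Or.inr rfl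

end Cyclic

section Dihedral

/-- The inclusion of the intersection of two subgroups. -/
def infInclusion (B : Fin 2 → Subgroup H) (i : Fin 2) : ↥(⨅ i, B i) →* B i :=
  Subgroup.inclusion (iInf_le B i)

theorem infInclusion_injective (B : Fin 2 → Subgroup H) (i : Fin 2) :
    Function.Injective (infInclusion B i) := Subgroup.inclusion_injective _

/-- The amalgam of two subgroups along their intersection. -/
abbrev InfAmalgam (B : Fin 2 → Subgroup H) : Type u := Monoid.PushoutI (infInclusion B)

/-- The canonical homomorphism from a subgroup to the amalgam. -/
def InfAmalgam.of (B : Fin 2 → Subgroup H) (i : Fin 2) : B i →* InfAmalgam B :=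
  Monoid.PushoutI.of (φ := infInclusion B) i

/-- The canonical homomorphism from the amalgam of two subgroups along their intersection. -/
def InfAmalgam.toGroup (B : Fin 2 → Subgroup H) : InfAmalgam B →* H :=
  Monoid.PushoutI.lift (fun i => (B i).subtype) (⨅ i, B i).subtype fun _ => rfl

theorem InfAmalgam.toGroup_of (B : Fin 2 → Subgroup H) (i : Fin 2) (x : B i) :
    InfAmalgam.toGroup B (InfAmalgam.of B i x) = x := Monoid.PushoutI.lift_of ..

theorem InfAmalgam.of_eq_of {B : Fin 2 → Subgroup H} {x : H} (h0 : x ∈ B 0) (h1 : x ∈ B 1) :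
    InfAmalgam.of B 0 ⟨x, h0⟩ = InfAmalgam.of B 1 ⟨x, h1⟩ := by
  have hx : x ∈ ⨅ i, B i := Subgroup.mem_iInf.2 (Fin.forall_fin_two.2 ⟨h0, h1⟩)
  exact (Monoid.PushoutI.of_apply_eq_base (infInclusion B) 0
    ⟨x, hx⟩).trans (Monoid.PushoutI.of_apply_eq_base (infInclusion B) 1 ⟨x, hx⟩).symm

open Classical in
/-- The element of the amalgam of truncations defined by an element of one of two subgroups. -/
noncomputable def dihedralApprox (D : Fin 2 → Subgroup H) (s : Finset H) (z : Σ i, D i) :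
    InfAmalgam fun i => truncation (D i) s :=
  if h : (z.2 : H) ∈ truncation (D z.1) s then
    InfAmalgam.of (fun i => truncation (D i) s) z.1 ⟨z.2, h⟩ else 1

theorem dihedralApprox_mk {D : Fin 2 → Subgroup H} {s : Finset H} {i : Fin 2} {d : D i}
    (h : (d : H) ∈ truncation (D i) s) : dihedralApprox D s ⟨i, d⟩ =
      InfAmalgam.of (fun i => truncation (D i) s) i ⟨d, h⟩ := dif_pos h

theorem eventually_toGroup_dihedralApprox (D : Fin 2 → Subgroup H) (z : Σ i, D i) :
    ∀ᶠ s in Filter.atTop, InfAmalgam.toGroup _ (dihedralApprox D s z) = z.2 := by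
  filter_upwards [eventually_mem_truncation z.2.2] with s hs
  rw [dihedralApprox_mk hs]
  exact InfAmalgam.toGroup_of ..

/-- The amalgam of the truncations of `D 0` and `D 1` along their intersection eventually identifies
the two copies of any given element of `T`, so in the limit the amalgam of `D 0` and `D 1` over `T`
is recovered. -/
theorem factorsThroughOneEdge_of_dihedral
    (hcard : ∀ B : Subgroup H, Finite B → IsUnit (Nat.card B : k)) {T : Subgroup H} [T.Normal]
    {D : Fin 2 → Subgroup H} (hDT : ∀ i, IsLocallyFinite (D i))
    (hTD : ∀ i, T ≤ D i) {r : Fin 2 → H} (hr : ∀ i, r i ∈ D i) (hrT : ∀ i, r i * r i ∈ T)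
    (hD : ∀ i, ∀ h ∈ D i, h ∈ T ∨ h * (r i)⁻¹ ∈ T)
    (hn : ∀ n : ℤ, (r 1 * r 0) ^ n ∈ T → n = 0) (hn' : ∀ n : ℤ, (r 1 * r 0) ^ n * r 0 ∉ T)
    (hgen : ∀ x, x ∈ Subgroup.closure (⋃ i, (D i : Set H))) : FactorsThroughOneEdge k H := by
  have := fun i => (hDT i).finite_truncation
  refine FactorsThroughOneEdge.of_eventually (l := Filter.atTop)
    (fun s => IsOneEdgeGroup.pushoutI (fun i => hcard (truncation (D i) s) inferInstance) _
      (infInclusion_injective _))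
    (eventually_toGroup_dihedralApprox D) ?_ ?_
  · rw [← MonoidHom.range_eq_top, eq_top_iff]
    refine fun x _ => (Subgroup.closure_le _).2 (Set.iUnion_subset fun i d hd => ?_) (hgen x)
    exact ⟨FreeGroup.of ⟨i, d, hd⟩, FreeGroup.lift_apply_of ..⟩
  let N := eventualRelations Filter.atTop (dihedralApprox D)
  let ι : ∀ i, D i →* FreeGroup (Σ i, D i) ⧸ N := fun i => MonoidHom.mk'
    (fun τ => QuotientGroup.mk (FreeGroup.of ⟨i, τ⟩)) fun σ τ => by
      rw [← QuotientGroup.mk_mul]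
      refine mk_eq_mk_of_eventually ?_
      filter_upwards [eventually_mem_truncation σ.2, eventually_mem_truncation τ.2] with s h1 h2
      rw [map_mul, FreeGroup.lift_apply_of, FreeGroup.lift_apply_of, FreeGroup.lift_apply_of,
        dihedralApprox_mk h1, dihedralApprox_mk h2, dihedralApprox_mk (mul_mem h1 h2), ← map_mul]
      rfl
  refine injective_of_normal_of_dihedral hTD hr hrT hD hn hn' (ι := ι)
    (fun i d => FreeGroup.lift_apply_of ..) (fun τ hτ => ?_) ?_
  · refine mk_eq_mk_of_eventually ?_
    filter_upwards [eventually_mem_truncation (hTD 0 hτ), eventually_mem_truncation (hTD 1 hτ)]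
      with s h0 h1
    rw [FreeGroup.lift_apply_of, FreeGroup.lift_apply_of, dihedralApprox_mk (d := ⟨τ, _⟩) h0,
      dihedralApprox_mk (d := ⟨τ, _⟩) h1]
    exact InfAmalgam.of_eq_of h0 h1
  · rw [← (MonoidHom.range_eq_top (f := QuotientGroup.mk' N)).2 (QuotientGroup.mk'_surjective N),
      MonoidHom.range_eq_map, ← FreeGroup.closure_range_of, MonoidHom.map_closure]
    refine le_antisymm ((Subgroup.closure_mono ?_)) (Subgroup.closure_mono ?_)
    · refine Set.iUnion_subset fun i => ?_
      rintro _ ⟨d, rfl⟩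
      exact ⟨_, ⟨⟨i, d⟩, rfl⟩, rfl⟩
    · rintro _ ⟨_, ⟨⟨i, d⟩, rfl⟩, rfl⟩
      exact Set.mem_iUnion.2 ⟨i, d, rfl⟩

end Dihedral

/-- A finite group is its own amalgam with the trivial group over the trivial group. -/
theorem IsOneEdgeGroup.of_finite [Finite H] (hH : IsUnit (Nat.card H : k)) :
    IsOneEdgeGroup k H := by
  let B : Fin 2 → Subgroup H := ![⊤, ⊥]
  have hB : ∀ i, IsUnit (Nat.card (B i) : k) := Fin.forall_fin_two.2
    ⟨by simpa [B] using hH, by simp [B]⟩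
  have hinj : Function.Injective (InfAmalgam.toGroup B) := by
    have hof : ∀ x : InfAmalgam B, ∃ b : B 0, x = InfAmalgam.of B 0 b := fun x => by
      induction x using Monoid.PushoutI.induction_on with
      | of i b =>
        match i with
        | 0 => exact ⟨b, rfl⟩
        | 1 =>
          obtain rfl : b = 1 := Subtype.ext b.2
          exact ⟨1, (map_one _).trans (map_one _).symm⟩
      | base c =>
        exact ⟨_, (Monoid.PushoutI.of_apply_eq_base (infInclusion B) 0 c).symm⟩
      | mul x y hx hy =>
        obtain ⟨x, rfl⟩ := hx
        obtain ⟨y, rfl⟩ := hy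
        exact ⟨x * y, (map_mul _ _ _).symm⟩
    refine (injective_iff_map_eq_one _).2 fun x hx => ?_
    obtain ⟨b, rfl⟩ := hof x
    have : (b : H) = 1 := (InfAmalgam.toGroup_of ..).symm.trans hx
    rw [show b = 1 from Subtype.ext this, map_one]
  have hsurj : Function.Surjective (InfAmalgam.toGroup B) := fun x =>
    ⟨InfAmalgam.of B 0 ⟨x, Subgroup.mem_top x⟩, InfAmalgam.toGroup_of ..⟩
  exact (IsOneEdgeGroup.pushoutI hB (infInclusion B) (infInclusion_injective B)).of_mulEquiv
    (MulEquiv.ofBijective _ ⟨hinj, hsurj⟩)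

/-! ### The three shapes of the action on the integers -/

section Cases

variable {χ : H →* ℤˣ} {c : H → ℤ}

theorem cocycle_one (hc : ∀ g h, c (g * h) = c g + χ g * c h) : c 1 = 0 := by
  have := hc 1 1
  rw [one_mul, map_one, Units.val_one, one_mul] at this
  omega

theorem cocycle_inv (hc : ∀ g h, c (g * h) = c g + χ g * c h) (g : H) : c g⁻¹ = -(χ g * c g) := by
  have h := hc g⁻¹ g
  rw [inv_mul_cancel, cocycle_one hc, map_inv, Int.units_inv_eq_self] at h
  omega

/-- The kernel of the homomorphism to the isometries of `ℤ` with linear part `χ` and translation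
part `c`. -/
def cocycleKer (hc : ∀ g h, c (g * h) = c g + χ g * c h) : Subgroup H where
  carrier := {g | χ g = 1 ∧ c g = 0}
  one_mem' := ⟨map_one χ, cocycle_one hc⟩
  mul_mem' {g h} hg hh := ⟨by rw [map_mul, hg.1, hh.1, one_mul], by rw [hc, hg.2, hh.2]; simp⟩
  inv_mem' {g} hg := ⟨by rw [map_inv, hg.1, inv_one], by rw [cocycle_inv hc, hg.2]; simp⟩

instance (hc : ∀ g h, c (g * h) = c g + χ g * c h) : (cocycleKer hc).Normal where
  conj_mem g hg x := by
    obtain ⟨h1, h2⟩ := hg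
    refine ⟨by simp [h1], ?_⟩
    rw [hc, hc, cocycle_inv hc, h2, map_mul, h1, mul_one, mul_zero, add_zero]
    obtain h | h := Int.units_eq_one_or (χ x) <;> simp [h]

theorem cocycle_zpow (hc : ∀ g h, c (g * h) = c g + χ g * c h) {t : H} (ht : χ t = 1) (n : ℤ) :
    c (t ^ n) = n * c t := by
  have hn : ∀ n : ℕ, c (t ^ n) = n * c t := fun n => by
    induction n with
    | zero => simp [cocycle_one hc]
    | succ n ih =>
      rw [pow_succ', hc, ih, ht]
      push_cast
      ring
  obtain ⟨n, rfl | rfl⟩ := n.eq_nat_or_neg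
  · simpa using hn n
  · rw [zpow_neg, cocycle_inv hc, zpow_natCast, map_pow, ht, hn]
    simp

/-- The stabilizer of half of an integer. -/
def cocycleStabilizer (hc : ∀ g h, c (g * h) = c g + χ g * c h) (a : ℤ) : Subgroup H where
  carrier := {g | 2 * c g = (1 - χ g) * a}
  one_mem' := by simp [cocycle_one hc]
  mul_mem' {g h} hg hh := by
    simp only [Set.mem_ofPred_eq] at hg hh ⊢
    rw [hc, map_mul, Units.val_mul]
    linear_combination hg + (χ g : ℤ) * hh
  inv_mem' {g} hg := by
    simp only [Set.mem_ofPred_eq] at hg ⊢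
    rw [cocycle_inv hc, map_inv, Int.units_inv_eq_self]
    obtain h | h := Int.units_eq_one_or (χ g) <;> simp [h] at hg ⊢ <;> omega

theorem mem_cocycleStabilizer {hc : ∀ g h, c (g * h) = c g + χ g * c h} {a : ℤ} {g : H} :
    g ∈ cocycleStabilizer hc a ↔ (χ g = 1 ∧ c g = 0) ∨ (χ g = -1 ∧ c g = a) := by
  change 2 * c g = (1 - χ g) * a ↔ _
  obtain h | h := Int.units_eq_one_or (χ g) <;> simp [h]

/-- `D` contains no non-zero translation, so its sign kernel, of finite index, embeds in the locally
finite kernel of the action. -/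
theorem isLocallyFinite_of_cocycle_eq_zero (hc : ∀ g h, c (g * h) = c g + χ g * c h)
    (hT : IsLocallyFinite (cocycleKer hc)) (D : Subgroup H)
    (hD : ∀ g ∈ D, χ g = 1 → c g = 0) : IsLocallyFinite D := by
  refine .of_finiteIndex (χ.comp D.subtype).ker ?_
  refine hT.of_injective (f := (D.subtype.comp (Subgroup.subtype _)).codRestrict _ fun g =>
    ⟨g.2, hD _ g.1.2 g.2⟩) fun g g' h => ?_
  exact Subtype.ext (Subtype.ext (congrArg (Subtype.val : cocycleKer hc → H) h))

theorem exists_cocycle_generator (hc : ∀ g h, c (g * h) = c g + χ g * c h) :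
    ∃ t, χ t = 1 ∧ ∀ g, χ g = 1 → ∃ n : ℤ, c g = n * c t := by
  let A : AddSubgroup ℤ :=
    { carrier := {z | ∃ g, χ g = 1 ∧ c g = z}
      zero_mem' := ⟨1, map_one χ, cocycle_one hc⟩
      add_mem' := by
        rintro _ _ ⟨g, hg, rfl⟩ ⟨h, hh, rfl⟩
        exact ⟨g * h, by rw [map_mul, hg, hh, one_mul], by rw [hc, hg]; simp⟩
      neg_mem' := by
        rintro _ ⟨g, hg, rfl⟩
        exact ⟨g⁻¹, by rw [map_inv, hg, inv_one], by rw [cocycle_inv hc, hg]; simp⟩ }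
  obtain ⟨a, ha⟩ := Int.subgroup_cyclic A
  have haA : a ∈ A := ha ▸ AddSubgroup.subset_closure rfl
  obtain ⟨t, ht, rfl⟩ := haA
  refine ⟨t, ht, fun g hg => ?_⟩
  have hg' : c g ∈ A := ⟨g, hg, rfl⟩
  rw [ha, AddSubgroup.mem_closure_singleton] at hg'
  obtain ⟨n, hn⟩ := hg'
  exact ⟨n, by simpa using hn.symm⟩

/-- Without translations `H` is locally finite and finitely generated, hence finite; without
reflections it is an extension of $\mathbb Z$; otherwise its image is infinite dihedral and it is
generated by the stabilizers of two points. -/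
theorem IsLocallyFiniteByDihedral.factorsThroughOneEdge [Group.FG H]
    (hH : IsLocallyFiniteByDihedral H)
    (hcard : ∀ B : Subgroup H, Finite B → IsUnit (Nat.card B : k)) :
    FactorsThroughOneEdge k H := by
  obtain ⟨χ, c, hc, hfin⟩ := hH
  have hT : IsLocallyFinite (cocycleKer hc) := fun K hK => by
    have := hfin _ (fg_map hK (Subgroup.subtype _)) (by rintro _ ⟨g, -, rfl⟩; exact g.2)
    exact Finite.of_equiv _ (K.equivMapOfInjective _ (Subgroup.subtype_injective _)).symm.toEquiv
  obtain ⟨t, ht, hgen⟩ := exists_cocycle_generator hc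
  have hmem : ∀ {g u : H} {n : ℤ}, χ g = 1 → χ u = 1 → c g = n * c u →
      g * (u ^ n)⁻¹ ∈ cocycleKer hc := fun {g u n} hg hu h => by
    refine ⟨by simp [hg, hu], ?_⟩
    rw [hc, hg, ← zpow_neg, cocycle_zpow hc hu, h]
    simp
  by_cases h0 : c t = 0
  · have hLF : IsLocallyFinite (⊤ : Subgroup H) :=
      isLocallyFinite_of_cocycle_eq_zero hc hT ⊤ fun g _ hg => by
        obtain ⟨n, hn⟩ := hgen g hg
        rw [hn, h0, mul_zero]
    have : Finite H := (hLF.of_injective (f := (Subgroup.topEquiv (G := H)).symm.toMonoidHom)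
      (Subgroup.topEquiv (G := H)).symm.injective).finite
    refine (IsOneEdgeGroup.of_finite ?_).factorsThroughOneEdge
    simpa using hcard ⊤ inferInstance
  have hzpow : ∀ u, χ u = 1 → c u = c t → ∀ n : ℤ, u ^ n ∈ cocycleKer hc → n = 0 :=
    fun u hu hut n hn => by
      have := hn.2
      rw [cocycle_zpow hc hu, hut] at this
      exact (mul_eq_zero.1 this).resolve_right h0
  by_cases hχ : ∀ g, χ g = 1
  · refine factorsThroughOneEdge_of_zpow hcard hT (hzpow t ht rfl) fun x => ?_
    obtain ⟨n, hn⟩ := hgen x (hχ x)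
    exact ⟨n, hmem (hχ x) ht hn⟩
  · push Not at hχ
    obtain ⟨r₀, hr₀⟩ := hχ
    replace hr₀ : χ r₀ = -1 := (Int.units_eq_one_or _).resolve_left hr₀
    -- Two reflections whose product has the translation length of `t`. They fix $c(r_i)/2$,
    -- neighbouring points of the dihedral action, and the subgroups `D i` are the stabilizers of
    -- these points.
    let r : Fin 2 → H := ![r₀, t * r₀]
    have hr : ∀ i, χ (r i) = -1 := Fin.forall_fin_two.2 ⟨hr₀, by simp [r, ht, hr₀]⟩
    have hu : χ (r 1 * r 0) = 1 := by rw [map_mul, hr, hr]; rfl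
    have hut : c (r 1 * r 0) = c t := by
      simp [r, hc, ht, hr₀]
    refine factorsThroughOneEdge_of_dihedral hcard (T := cocycleKer hc)
      (D := fun i => cocycleStabilizer hc (c (r i))) (fun i => ?_)
      (fun i g hg => mem_cocycleStabilizer.2 (Or.inl hg)) (r := r)
      (fun i => mem_cocycleStabilizer.2 (Or.inr ⟨hr i, rfl⟩)) (fun i => ⟨?_, ?_⟩)
      (fun i g hg => (mem_cocycleStabilizer.1 hg).imp id fun h => ⟨?_, ?_⟩)
      (hzpow _ hu hut) (fun n h => ?_) fun x => ?_
    · refine isLocallyFinite_of_cocycle_eq_zero hc hT _ fun g hg h1 => ?_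
      obtain h | h := mem_cocycleStabilizer.1 hg
      · exact h.2
      · rw [h.1] at h1
        exact absurd h1 (by decide)
    · rw [map_mul, hr]; rfl
    · rw [hc, hr]; simp
    · rw [map_mul, map_inv, h.1, hr]; rfl
    · rw [hc, cocycle_inv hc, h.1, h.2, hr]; simp
    · have := h.1
      rw [map_mul, map_zpow, hu, one_zpow, one_mul, hr] at this
      exact absurd this (by decide)
    · have hD : ∀ i, ∀ d ∈ cocycleStabilizer hc (c (r i)), d ∈ Subgroup.closure
          (⋃ i, (cocycleStabilizer hc (c (r i)) : Set H)) := fun i d hd =>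
        Subgroup.subset_closure (Set.mem_iUnion.2 ⟨i, hd⟩)
      have hrD : ∀ i, r i ∈ Subgroup.closure
          (⋃ i, (cocycleStabilizer hc (c (r i)) : Set H)) := fun i =>
        hD i _ (mem_cocycleStabilizer.2 (Or.inr ⟨hr i, rfl⟩))
      have h1 : ∀ x, χ x = 1 → x ∈ Subgroup.closure
          (⋃ i, (cocycleStabilizer hc (c (r i)) : Set H)) := fun x hx => by
        obtain ⟨n, hn⟩ := hgen x hx
        rw [← inv_mul_cancel_right x ((r 1 * r 0) ^ n), ← inv_inv ((r 1 * r 0) ^ n)]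
        refine mul_mem (hD 0 _ (mem_cocycleStabilizer.2 (Or.inl ?_)))
          (inv_mem (inv_mem (zpow_mem (mul_mem (hrD 1) (hrD 0)) n)))
        rw [inv_inv]
        exact hmem hx hu (hut ▸ hn)
      obtain hx | hx := Int.units_eq_one_or (χ x)
      · exact h1 x hx
      · rw [← inv_mul_cancel_right x (r 0)]
        exact mul_mem (h1 _ (by rw [map_mul, map_inv, hx, hr]; rfl)) (hrD 0)

end Cases

end GroupDim

namespace GroupDim

/-! ### The filtered category of one-edge groups over `G` -/

variable {k : Type u} [CommRing k] {G : Type u} [Group G]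

/-- The image of a finitely presented group is a finitely generated subgroup, to which the structure
theorem applies. -/
theorem ElementaryAmenable.factorsThroughOneEdge [Nontrivial k] (hG : ElementaryAmenable G)
    (hk : SmallHomology k G) : FactorsThroughOneEdge k G := by
  intro X _ hX f
  obtain ⟨n, φ, hφ, -⟩ := hX.out
  have hfg : f.range.FG := by
    have : f.range = (⊤ : Subgroup (FreeGroup (Fin n))).map (f.comp φ) := by
      rw [← Subgroup.map_map, Subgroup.map_top_of_surjective φ hφ, MonoidHom.range_eq_map]
    rw [this]
    exact fg_map Group.FG.out _
  have : Group.FG f.range := (Group.fg_iff_subgroup_fg _).2 hfg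
  obtain ⟨P, _, a, b, hP, hab⟩ :=
    (hG.isLocallyFiniteByDihedral hk f.range hfg).factorsThroughOneEdge
    (fun B _ => (hk.subgroup f.range).isUnit_natCard B) X f.rangeRestrict
  refine ⟨P, _, a, f.range.subtype.comp b, hP, ?_⟩
  rw [MonoidHom.comp_assoc, hab, MonoidHom.subtype_comp_rangeRestrict]

variable (k G) in
/-- Homomorphisms to `G` from quotients of free groups of finite rank that are fundamental groups of
graphs of finite groups with a single edge. -/
structure OneEdgeOver where
  /-- the rank of the free group -/
  rank : ℕ
  /-- the relations -/
  rel : Subgroup (FreeGroup (ULift.{u} (Fin rank)))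
  normal : rel.Normal
  isOneEdgeGroup : IsOneEdgeGroup k (FreeGroup (ULift.{u} (Fin rank)) ⧸ rel)
  /-- the homomorphism to `G` -/
  hom : FreeGroup (ULift.{u} (Fin rank)) ⧸ rel →* G

namespace OneEdgeOver

instance (j : OneEdgeOver k G) : j.rel.Normal := j.normal

/-- The source of the homomorphism to `G`. -/
abbrev Grp (j : OneEdgeOver k G) : Type u := FreeGroup (ULift.{u} (Fin j.rank)) ⧸ j.rel

instance : SmallCategory (OneEdgeOver k G) where
  Hom i j := {g : i.Grp →* j.Grp // j.hom.comp g = i.hom}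
  id i := ⟨MonoidHom.id _, rfl⟩
  comp f g := ⟨g.1.comp f.1, by rw [← MonoidHom.comp_assoc, g.2, f.2]⟩

/-- One-edge groups are finitely generated, so quotients of free groups of finite rank form a small
set of models. -/
theorem exists_mulEquiv {P : Type u} [Group P] (hP : IsOneEdgeGroup k P) (b : P →* G) :
    ∃ (j : OneEdgeOver k G) (ε : P ≃* j.Grp), j.hom.comp ε.toMonoidHom = b := by
  obtain ⟨n, φ, hφ, -⟩ := hP.isFinitelyPresented.out
  let ψ : FreeGroup (ULift.{u} (Fin n)) →* P := φ.comp (FreeGroup.map ULift.down)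
  have hψ : Function.Surjective ψ := hφ.comp (FreeGroup.map_surjective ULift.down_surjective)
  let ε := QuotientGroup.quotientKerEquivOfSurjective ψ hψ
  refine ⟨⟨n, ψ.ker, inferInstance, hP.of_mulEquiv ε.symm, b.comp ε.toMonoidHom⟩, ε.symm, ?_⟩
  ext x
  exact congrArg b (ε.apply_symm_apply x)

theorem exists_comp_eq (hG : FactorsThroughOneEdge k G) {X : Type u} [Group X]
    [Group.IsFinitelyPresented X] (f : X →* G) :
    ∃ (j : OneEdgeOver k G) (a : X →* j.Grp), j.hom.comp a = f := by
  obtain ⟨P, _, a, b, hP, hab⟩ := hG X f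
  obtain ⟨j, ε, hε⟩ := exists_mulEquiv hP b
  exact ⟨j, ε.toMonoidHom.comp a, by rw [← MonoidHom.comp_assoc, hε, hab]⟩

/-- Dividing by finitely many elements keeps the group finitely presented, so the induced map to `G`
factors through a one-edge group. -/
theorem exists_hom_eq_one (hG : FactorsThroughOneEdge k G) (i : OneEdgeOver k G)
    {S : Set i.Grp} (hS : S.Finite) (h : ∀ s ∈ S, i.hom s = 1) :
    ∃ (j : OneEdgeOver k G) (f : i ⟶ j), ∀ s ∈ S, f.1 s = 1 := by
  have := i.isOneEdgeGroup.isFinitelyPresented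
  have := Group.IsFinitelyPresented.quotient (Subgroup.normalClosure S) ⟨S, hS, rfl⟩
  obtain ⟨j, a, ha⟩ := exists_comp_eq hG (QuotientGroup.lift (Subgroup.normalClosure S) i.hom
    (Subgroup.normalClosure_le_normal h))
  refine ⟨j, ⟨a.comp (QuotientGroup.mk' _), ?_⟩, fun s hs => ?_⟩
  · rw [← MonoidHom.comp_assoc, ha]
    ext x
    rfl
  · rw [MonoidHom.comp_apply, QuotientGroup.mk'_apply,
      (QuotientGroup.eq_one_iff s).2 (Subgroup.subset_normalClosure hs), map_one]

theorem exists_hom_apply_eq (hG : FactorsThroughOneEdge k G) (i : OneEdgeOver k G) {ι : Type*}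
    [Finite ι] {x y : ι → i.Grp} (h : ∀ n, i.hom (x n) = i.hom (y n)) :
    ∃ (j : OneEdgeOver k G) (f : i ⟶ j), ∀ n, f.1 (x n) = f.1 (y n) := by
  obtain ⟨j, f, hf⟩ := exists_hom_eq_one hG i (Set.finite_range fun n => x n * (y n)⁻¹) (by
    rintro _ ⟨n, rfl⟩
    rw [map_mul, map_inv, h, mul_inv_cancel])
  refine ⟨j, f, fun n => ?_⟩
  have := hf _ ⟨n, rfl⟩
  rwa [map_mul, map_inv, mul_inv_eq_one] at this

/-- Two objects are dominated by factoring their free product; two parallel arrows are equalized by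
identifying their values on finitely many generators. -/
theorem isFiltered (hG : FactorsThroughOneEdge k G) : IsFiltered (OneEdgeOver k G) where
  cocone_objs i j := by
    have := i.isOneEdgeGroup.isFinitelyPresented
    have := j.isOneEdgeGroup.isFinitelyPresented
    obtain ⟨l, a, ha⟩ := exists_comp_eq hG (Monoid.Coprod.lift i.hom j.hom)
    refine ⟨l, ⟨a.comp Monoid.Coprod.inl, ?_⟩, ⟨a.comp Monoid.Coprod.inr, ?_⟩, trivial⟩
    · rw [← MonoidHom.comp_assoc, ha, Monoid.Coprod.lift_comp_inl]
    · rw [← MonoidHom.comp_assoc, ha, Monoid.Coprod.lift_comp_inr]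
  cocone_maps i j f g := by
    obtain ⟨l, h, hh⟩ := exists_hom_apply_eq hG j
      (x := fun n => f.1 (QuotientGroup.mk (FreeGroup.of n)))
      (y := fun n => g.1 (QuotientGroup.mk (FreeGroup.of n)))
      (fun n => DFunLike.congr_fun (f.2.trans g.2.symm) _)
    refine ⟨l, h, Subtype.ext (QuotientGroup.monoidHom_ext _ (FreeGroup.ext_hom _ _ fun n => ?_))⟩
    exact hh n
  nonempty := by
    obtain ⟨j, -, -⟩ := exists_comp_eq (X := PUnit) hG 1
    exact ⟨j⟩

variable (k G)

/-- The functor sending a homomorphism to its source. -/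
def functor : OneEdgeOver k G ⥤ GrpCat.{u} where
  obj j := GrpCat.of j.Grp
  map f := GrpCat.ofHom f.1

/-- The cocone with apex `G`. -/
def cocone : Cocone (functor k G) where
  pt := GrpCat.of G
  ι.app j := GrpCat.ofHom j.hom
  ι.naturality _ _ f := GrpCat.hom_ext f.2

variable {k G}

/-- The colimit is tested on underlying sets. An element of `G` is a map from the free group on one
generator, which factors; two elements with equal image in `G` become equal at a later stage. -/
theorem nonempty_isColimit (hG : FactorsThroughOneEdge k G) :
    Nonempty (IsColimit (cocone k G)) := by
  have := isFiltered hG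
  have : HasColimit (functor k G) :=
    ⟨⟨_, GrpCat.FilteredColimits.colimitCoconeIsColimit (functor k G)⟩⟩
  have : ReflectsColimit (functor k G) (forget GrpCat.{u}) :=
    reflectsColimit_of_reflectsIsomorphisms _ _
  refine ⟨isColimitOfReflects (forget GrpCat.{u})
    (Types.FilteredColimit.isColimitOf' _ _ (fun x => ?_) fun i x y h => ?_)⟩
  · obtain ⟨j, a, ha⟩ := exists_comp_eq hG
      (FreeGroup.lift (fun _ : PUnit.{u + 1} => (x : G)))
    refine ⟨j, a (FreeGroup.of PUnit.unit), ?_⟩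
    exact ((DFunLike.congr_fun ha (FreeGroup.of PUnit.unit)).trans
      (FreeGroup.lift_apply_of ..)).symm
  · obtain ⟨j, f, hf⟩ := exists_hom_apply_eq hG i (ι := Unit) (x := fun _ => x) (y := fun _ => y)
      fun _ => h
    exact ⟨j, f, hf ()⟩

end OneEdgeOver

end GroupDim

theorem mainTheorem4 (k : Type u) [CommRing k] [Nontrivial k] (G : Type u) [Group G]
    (hG : GroupDim.ElementaryAmenable G) (hhd : GroupDim.hd k G ≤ 1) :
    GroupDim.IsFilteredColimitOf
      (fun (H : Type u) [Group H] => GroupDim.cd k H ≤ 1 ∧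
        (GroupDim.IsHNNExtensionOfFinite H ∨ GroupDim.IsAmalgamOfFinite H)) G := by
  have h := hG.factorsThroughOneEdge (GroupDim.smallHomology_of_hd_le_one hhd)
  exact ⟨GroupDim.OneEdgeOver k G, inferInstance, GroupDim.OneEdgeOver.isFiltered h,
    GroupDim.OneEdgeOver.functor k G, GroupDim.OneEdgeOver.cocone k G,
    GroupDim.OneEdgeOver.nonempty_isColimit h, ⟨MulEquiv.refl G⟩, fun j =>
      ⟨j.isOneEdgeGroup.cd_le_one,
        j.isOneEdgeGroup.isHNNExtensionOfFinite_or_isAmalgamOfFinite⟩⟩
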